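/- **Setting.** Let $(\mathcal M,\otimes,\mathbb I)$ be a symmetric monoidal abelian category that is bicomplete and locally small (each object has only a set of subobjects), with $\otimes$ right exact in each variable. Associativity and unit constraints are suppressed. Put $\mathcal Z=\mathrm{Hom}_{\mathcal M}(\mathbb I,-)$ and assume that $\mathcal Z$ is faithful. Let $(A,m,u)$ be a monoid in $\mathcal M$. For $t\in\mathcal Z(A)$ and $f:M\to A$ let $t\triangleright f=m\circ(t\otimes f)$ and $f\triangleleft t=m\circ(f\otimes t)$, as morphisms $M\to A$; write $t\triangleright A$, $A\triangleleft t$ when $f=\mathrm{id}_A$. The ring $\mathcal Z(A)$, with product $s\cdot t=m\circ(s\otimes t)$ and unit $u$, is an algebra over the commutative ring $\mathcal Z(\mathbb I)=\mathrm{End}(\mathbb I)$ through $t\mapsto u\circ t$. *Assumptions on $A$.* $A$ is an Azumaya monoid, that is, the functor $A\otimes-$ from $\mathcal M$ to the category of $A$-bimodules (equivalently, left modules over the enveloping monoid $A\otimes A^{o}$) is an equivalence and $m:A\otimes A\to A$ splits as a morphism of $A$-bimodules. Moreover $A$ has a left internal hom (the functor $A\otimes-:\mathcal M\to\mathcal M$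 has a right adjoint), and $A\otimes A\,|\,A$, that is, the $A$-bimodule $A\otimes A$ with outer actions is a direct summand of a finite direct sum of copies of the $A$-bimodule $A$. It follows that $u$ is a monomorphism. *Invertible subobjects.* $\mathrm{Inv}_{\mathbb I}(A)$ is the set of subobjects $i_X:X\hookrightarrow A$ for which there are a subobject $i_Y:Y\hookrightarrow A$ and isomorphisms $m_X:X\otimes Y\cong\mathbb I$, $m_Y:Y\otimes X\cong\mathbb I$ such that $u\circ m_X=m\circ(i_X\otimes i_Y)$ and $u\circ m_Y=m\circ(i_Y\otimes i_X)$. It is a group: the product of $X$ and $X'$ is $X\otimes X'$ with the monomorphism $m\circ(i_X\otimes i_{X'})$, the neutral element is $(\mathbb I,u)$, and the inverse of $X$ is $Y$. For $X\in\mathrm{Inv}_{\mathbb I}(A)$ let $$\Phi_X(t)=m\circ\bigl(i_X\otimes(t\triangleright i_Y)\bigr)\circ m_X^{-1}\quad(t\in\mathcal Z(A)),$$ and let $\Gamma_X:A\to A$ be the composite $$A\xrightarrow{A\otimes m_X^{-1}}A\otimes X\otimes Y\xrightarrow{\ \cong\ }X\otimes A\otimes Y\xrightarrow{i_X\otimes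 A\otimes i_Y}A\otimes A\otimes A\to A,$$ where the isomorphism is the symmetry of $A$ and $X$ tensored with $Y$, and the last arrow is the multiplication. *The sets $\mathcal G$ and $\mathcal H$.* For maps $\sigma,\delta$ from $\mathcal Z(A)$ to itself let ${}_\sigma J_\delta\hookrightarrow A$ be the intersection over all $t\in\mathcal Z(A)$ of the equalizers of $\sigma(t)\triangleright A$ and $A\triangleleft\delta(t)$. Multiplication of $A$ induces morphisms ${}_\sigma J_\delta\otimes{}_\delta J_\tau\to{}_\sigma J_\tau$, making ${}_\delta J_\delta$ a monoid, and these induce $\overline m^{\delta}_{\sigma,\tau}:{}_\sigma J_\delta\otimes_{{}_\delta J_\delta}{}_\delta J_\tau\to{}_\sigma J_\tau$. Let $\mathcal G$ be the set of $\theta\in\mathrm{Aut}_{\mathcal Z(\mathbb I)\text{-alg}}(\mathcal Z(A))$ such that ${}_\theta J_1$ is two-sided invertible, that is, $\overline m^{1}_{\theta,\theta}$ and $\overline m^{\theta}_{1,1}$ are isomorphisms. For $\sigma,\tau\in\mathrm{Aut}_{\mathcal Z(\mathbb I)\text{-alg}}(\mathcal Z(A))$, a morphism $A_\sigma\to A_\tau$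 is a left $A$-linear $f:A\to A$ with $f\circ(A\triangleleft\sigma(z))=f\triangleleft\tau(z)$ for all $z\in\mathcal Z(A)$. Write $A_\sigma\,|\,A_\tau$ if there are $k\ge1$ and morphisms $f_l:A_\sigma\to A_\tau$, $g_l:A_\tau\to A_\sigma$ ($1\le l\le k$) with $\sum_l g_l\circ f_l=\mathrm{id}_A$, and $A_\sigma\sim A_\tau$ if both $A_\sigma\,|\,A_\tau$ and $A_\tau\,|\,A_\sigma$. Let $\mathcal H=\{\theta\in\mathrm{Aut}_{\mathcal Z(\mathbb I)\text{-alg}}(\mathcal Z(A)) : A_\theta\sim A_1\}$. Finally let $\mathrm{Aut}_{alg}(A)$ be the group of automorphisms of the monoid $A$, and $\Omega:\mathrm{Aut}_{alg}(A)\to\mathrm{Aut}_{\mathcal Z(\mathbb I)\text{-alg}}(\mathcal Z(A))$ the homomorphism $\gamma\mapsto\mathcal Z(\gamma)=(t\mapsto\gamma\circ t)$. **Claim.** $\mathcal G=\mathcal H$, and this set is a subgroup of $\mathrm{Aut}_{\mathcal Z(\mathbb I)\text{-alg}}(\mathcal Z(A))$; let $\varsigma$ be its inclusion. The assignment $X\mapsto\Phi_X$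 is a group homomorphism $\Phi:\mathrm{Inv}_{\mathbb I}(A)\to\mathrm{Aut}_{\mathcal Z(\mathbb I)\text{-alg}}(\mathcal Z(A))$ (the Miyashita action), which corestricts to a group isomorphism $\widehat\Phi:\mathrm{Inv}_{\mathbb I}(A)\to\mathcal G$. The assignment $X\mapsto\Gamma_X$ is a group isomorphism $\Gamma:\mathrm{Inv}_{\mathbb I}(A)\to\mathrm{Aut}_{alg}(A)$. The map $\Omega$ is injective and corestricts to a group isomorphism $\omega:\mathrm{Aut}_{alg}(A)\to\mathcal G$. These maps form a commutative diagram: $$\Omega\circ\Gamma=\Phi,\qquad \varsigma\circ\omega=\Omega,\qquad \varsigma\circ\widehat\Phi=\Phi,\qquad \omega\circ\Gamma=\widehat\Phi .$$ -/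

import Mathlib

open CategoryTheory CategoryTheory.MonoidalCategory CategoryTheory.Limits

universe v u

namespace AzumayaMonoid

open MonObj

noncomputable section

/-! ### Global sections and the actions `t ▷ f`, `f ◁ t` -/

section Sections

variable {C : Type u} [Category.{v} C] [MonoidalCategory C]

/-- The underlying set of `Z(A) = Hom(𝟙, A)`. -/
def ZObj (A : Mon C) : Type v := 𝟙_ C ⟶ A.X

/-- `t ▷ h : M ≅ 𝟙 ⊗ M ⟶ A ⊗ N ⟶ N` for `t : 𝟙 ⟶ A`, `h : M ⟶ N`, `N` an `A`-bimodule. -/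
def triLeft {A : Mon C} {M : C} (N : Bimod A A) (t : ZObj A) (h : M ⟶ N.X) : M ⟶ N.X :=
  (λ_ M).inv ≫ ((t : 𝟙_ C ⟶ A.X) ⊗ₘ h) ≫ N.actLeft

/-- `h ◁ t : M ≅ M ⊗ 𝟙 ⟶ N ⊗ A ⟶ N` for `t : 𝟙 ⟶ A`, `h : M ⟶ N`, `N` an `A`-bimodule. -/
def triRight {A : Mon C} {M : C} (N : Bimod A A) (h : M ⟶ N.X) (t : ZObj A) : M ⟶ N.X :=
  (ρ_ M).inv ≫ (h ⊗ₘ (t : 𝟙_ C ⟶ A.X)) ≫ N.actRight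

/-- Convolution product on `Z(A)`. -/
def zMul {A : Mon C} (s t : ZObj A) : ZObj A :=
  (λ_ (𝟙_ C)).inv ≫ ((s : 𝟙_ C ⟶ A.X) ⊗ₘ (t : 𝟙_ C ⟶ A.X)) ≫ μ[A.X]

theorem conv_assoc {A : C} [MonObj A] (a b c : 𝟙_ C ⟶ A) :
    (λ_ (𝟙_ C)).inv ≫ (((λ_ (𝟙_ C)).inv ≫ (a ⊗ₘ b) ≫ μ) ⊗ₘ c) ≫ μ =
      (λ_ (𝟙_ C)).inv ≫ (a ⊗ₘ ((λ_ (𝟙_ C)).inv ≫ (b ⊗ₘ c) ≫ μ)) ≫ μ := by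
  have h1 : (((λ_ (𝟙_ C)).inv ≫ (a ⊗ₘ b) ≫ μ) ⊗ₘ c) =
      (λ_ (𝟙_ C)).inv ▷ _ ≫ ((a ⊗ₘ b) ⊗ₘ c) ≫ μ ▷ A := by
    rw [← tensorHom_id, ← tensorHom_id, tensorHom_comp_tensorHom, tensorHom_comp_tensorHom,
      Category.comp_id, Category.id_comp]
  have h2 : (a ⊗ₘ ((λ_ (𝟙_ C)).inv ≫ (b ⊗ₘ c) ≫ μ)) =
      _ ◁ (λ_ (𝟙_ C)).inv ≫ (a ⊗ₘ (b ⊗ₘ c)) ≫ A ◁ μ := by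
    rw [← id_tensorHom, ← id_tensorHom, tensorHom_comp_tensorHom, tensorHom_comp_tensorHom,
      Category.comp_id, Category.id_comp]
  rw [h1, h2]
  simp only [Category.assoc, MonObj.mul_assoc, associator_naturality_assoc]
  monoidal

theorem one_conv {A : C} [MonObj A] (a : 𝟙_ C ⟶ A) :
    (λ_ (𝟙_ C)).inv ≫ (η ⊗ₘ a) ≫ μ = a := by
  simp [MonoidalCategory.tensorHom_def']

theorem conv_one {A : C} [MonObj A] (a : 𝟙_ C ⟶ A) :
    (λ_ (𝟙_ C)).inv ≫ (a ⊗ₘ η) ≫ μ = a := by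
  have : (a ⊗ₘ η[A]) ≫ μ = (ρ_ (𝟙_ C)).hom ≫ a := by simp [MonoidalCategory.tensorHom_def]
  rw [this, unitors_inv_equal, Iso.inv_hom_id_assoc]

theorem unit_conv {A : C} [MonObj A] (s : 𝟙_ C ⟶ 𝟙_ C) (a : 𝟙_ C ⟶ A) :
    (λ_ (𝟙_ C)).inv ≫ ((s ≫ η) ⊗ₘ a) ≫ μ = s ≫ a := by
  have : ((s ≫ η[A]) ⊗ₘ a) = s ▷ _ ≫ (η[A] ⊗ₘ a) := by simp [MonoidalCategory.tensorHom_def]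
  rw [this, Category.assoc, unitors_inv_equal, ← rightUnitor_inv_naturality_assoc,
    ← unitors_inv_equal, one_conv]

theorem conv_unit {A : C} [MonObj A] (s : 𝟙_ C ⟶ 𝟙_ C) (a : 𝟙_ C ⟶ A) :
    (λ_ (𝟙_ C)).inv ≫ (a ⊗ₘ (s ≫ η)) ≫ μ = s ≫ a := by
  have : (a ⊗ₘ (s ≫ η[A])) = _ ◁ s ≫ (a ⊗ₘ η[A]) := by simp [MonoidalCategory.tensorHom_def']
  rw [this, Category.assoc, ← leftUnitor_inv_naturality_assoc, conv_one]

theorem end_comm (f g : 𝟙_ C ⟶ 𝟙_ C) : f ≫ g = g ≫ f := by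
  have h1 : f ≫ (λ_ (𝟙_ C)).inv = (λ_ (𝟙_ C)).inv ≫ 𝟙_ C ◁ f := leftUnitor_inv_naturality f
  have h2 : g ≫ (λ_ (𝟙_ C)).inv = (λ_ (𝟙_ C)).inv ≫ g ▷ 𝟙_ C := by
    rw [unitors_inv_equal]; exact rightUnitor_inv_naturality g
  rw [← cancel_mono (λ_ (𝟙_ C)).inv, Category.assoc, Category.assoc, h1, h2, reassoc_of% h1,
    reassoc_of% h2, whisker_exchange]

theorem conv_map {A B : Mon C} (f : A ⟶ B) (s t : 𝟙_ C ⟶ A.X) :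
    ((λ_ (𝟙_ C)).inv ≫ (s ⊗ₘ t) ≫ μ[A.X]) ≫ f.hom =
      (λ_ (𝟙_ C)).inv ≫ ((s ≫ f.hom) ⊗ₘ (t ≫ f.hom)) ≫ μ[B.X] := by
  simp

end Sections

section Ring

variable {C : Type u} [Category.{v} C] [Preadditive C] [MonoidalCategory C]

/-- `Z(𝟙) = End(𝟙)` is commutative. -/
instance : CommRing (End (𝟙_ C)) :=
  { (inferInstance : Ring (End (𝟙_ C))) with
    mul_comm := fun f g => end_comm (C := C) g f }

variable [MonoidalPreadditive C]

instance (A : Mon C) : AddCommGroup (ZObj A) :=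
  inferInstanceAs (AddCommGroup (𝟙_ C ⟶ A.X))

/-- `Z(A)` is a ring for the convolution product, with unit `u : 𝟙 ⟶ A`. -/
instance (A : Mon C) : Ring (ZObj A) :=
  { (inferInstance : AddCommGroup (ZObj A)) with
    mul := zMul
    one := η[A.X]
    left_distrib := fun a b c => by
      change zMul a (b + c) = zMul a b + zMul a c
      simp only [zMul]
      erw [MonoidalPreadditive.tensor_add, Preadditive.add_comp, Preadditive.comp_add]
      rfl
    right_distrib := fun a b c => by
      change zMul (a + b) c = zMul a c + zMul b c
      simp only [zMul]
      erw [MonoidalPreadditive.add_tensor, Preadditive.add_comp, Preadditive.comp_add]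
      rfl
    zero_mul := fun a => by
      change zMul 0 a = 0
      simp only [zMul]
      erw [MonoidalPreadditive.zero_tensor, zero_comp, comp_zero]
      rfl
    mul_zero := fun a => by
      change zMul a 0 = 0
      simp only [zMul]
      erw [MonoidalPreadditive.tensor_zero, zero_comp, comp_zero]
      rfl
    mul_assoc := fun a b c => conv_assoc (C := C) (A := A.X) a b c
    one_mul := fun a => one_conv (C := C) (A := A.X) a
    mul_one := fun a => conv_one (C := C) (A := A.X) a }

/-- The structure map `Z(u) : Z(𝟙) ⟶ Z(A)`. -/
def zUnit (A : Mon C) : End (𝟙_ C) →+* ZObj A where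
  toFun t := (t : 𝟙_ C ⟶ 𝟙_ C) ≫ η[A.X]
  map_one' := Category.id_comp _
  map_zero' := zero_comp
  map_add' s t := Preadditive.add_comp _ _ _ _ _ _
  map_mul' s t := by
    change ((t : 𝟙_ C ⟶ 𝟙_ C) ≫ (s : 𝟙_ C ⟶ 𝟙_ C)) ≫ η[A.X] = _
    rw [end_comm, Category.assoc]
    exact (unit_conv (C := C) (A := A.X) s ((t : 𝟙_ C ⟶ 𝟙_ C) ≫ η[A.X])).symm

/-- `Z(A)` is a `Z(𝟙)`-algebra through `Z(u)`. -/
instance (A : Mon C) : Algebra (End (𝟙_ C)) (ZObj A) :=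
  (zUnit A).toAlgebra' fun s a =>
    (unit_conv (C := C) (A := A.X) s a).trans (conv_unit (C := C) (A := A.X) s a).symm

/-- `Aut_{Z(𝟙)-alg}(Z(A))`. -/
abbrev AutZ (A : Mon C) : Type v := ZObj A ≃ₐ[End (𝟙_ C)] ZObj A

/-- `Ω : Aut_alg(A) ⟶ Aut_{Z(𝟙)-alg}(Z(A))`, `e ↦ Z(e) = (t ↦ e ∘ t)`. -/
def Omega (A : Mon C) : Aut A →* AutZ A where
  toFun e :=
    { toFun := fun t => (t : 𝟙_ C ⟶ A.X) ≫ e.hom.hom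
      invFun := fun t => (t : 𝟙_ C ⟶ A.X) ≫ e.inv.hom
      left_inv := fun t => by
        have h (s : 𝟙_ C ⟶ A.X) : (s ≫ e.hom.hom) ≫ e.inv.hom = s := by
          rw [Category.assoc, ← Mon.comp_hom', e.hom_inv_id]
          exact Category.comp_id _
        exact h t
      right_inv := fun t => by
        have h (s : 𝟙_ C ⟶ A.X) : (s ≫ e.inv.hom) ≫ e.hom.hom = s := by
          rw [Category.assoc, ← Mon.comp_hom', e.inv_hom_id]
          exact Category.comp_id _
        exact h t
      map_mul' := fun s t => conv_map e.hom s t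
      map_add' := fun s t => Preadditive.add_comp _ _ _ _ _ _
      commutes' := fun t => by
        change ((t : 𝟙_ C ⟶ 𝟙_ C) ≫ η[A.X]) ≫ e.hom.hom = (t : 𝟙_ C ⟶ 𝟙_ C) ≫ η[A.X]
        simp }
  map_one' := by
    ext t
    exact Category.comp_id _
  map_mul' e e' := by
    ext t
    exact (Category.assoc _ _ _).symm

end Ring

/-! ### Invertible subobjects -/

section Inv

variable {C : Type u} [Category.{v} C] [MonoidalCategory C]

theorem tensor_comp_left {X Y Z X' Y' : C} (f : X ⟶ Y) (g : Y ⟶ Z) (h : X' ⟶ Y') :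
    (f ≫ g) ⊗ₘ h = (f ⊗ₘ h) ≫ g ▷ Y' := by
  rw [← tensorHom_id, tensorHom_comp_tensorHom, Category.comp_id]

theorem tensor_comp_right {X Y Z X' Y' : C} (f : X ⟶ Y) (g : Y ⟶ Z) (h : X' ⟶ Y') :
    h ⊗ₘ (f ≫ g) = (h ⊗ₘ f) ≫ Y' ◁ g := by
  rw [← id_tensorHom, tensorHom_comp_tensorHom, Category.comp_id]

/-- The data exhibiting subobjects `i : X ⟶ A` and `j : Y ⟶ A` as two-sided inverses of each
other: isomorphisms `X ⊗ Y ≅ 𝟙` and `Y ⊗ X ≅ 𝟙` compatible with the multiplication of `A`. -/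
structure InverseDatum (A : Mon C) {X Y : C} (i : X ⟶ A.X) (j : Y ⟶ A.X) where
  /-- The isomorphism `m_X : X ⊗ Y ≅ 𝟙`. -/
  mX : X ⊗ Y ≅ 𝟙_ C
  /-- The isomorphism `m_Y : Y ⊗ X ≅ 𝟙`. -/
  mY : Y ⊗ X ≅ 𝟙_ C
  mX_unit : mX.hom ≫ η[A.X] = (i ⊗ₘ j) ≫ μ[A.X]
  mY_unit : mY.hom ≫ η[A.X] = (j ⊗ₘ i) ≫ μ[A.X]

/-- A subobject of `A` is (two-sided) invertible if it has a two-sided inverse. -/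
def IsInvertible {A : Mon C} (x : Subobject A.X) : Prop :=
  ∃ y : Subobject A.X, Nonempty (InverseDatum A x.arrow y.arrow)

/-- `Inv_𝟙(A)`, the set of two-sided invertible subobjects of `A`. -/
def Inv (A : Mon C) : Type (max u v) := {x : Subobject A.X // IsInvertible x}

namespace InverseDatum

variable {A : Mon C} {X Y X' Y' : C} {i : X ⟶ A.X} {j : Y ⟶ A.X} {i' : X' ⟶ A.X} {j' : Y' ⟶ A.X}

/-- Exchange the roles of the two subobjects. -/
def symm (d : InverseDatum A i j) : InverseDatum A j i := ⟨d.mY, d.mX, d.mY_unit, d.mX_unit⟩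

/-- The unit subobject is its own inverse. -/
def unit (A : Mon C) : InverseDatum A η[A.X] η[A.X] where
  mX := λ_ _
  mY := λ_ _
  mX_unit := by simp [MonoidalCategory.tensorHom_def']
  mY_unit := by simp [MonoidalCategory.tensorHom_def']

/-- Transport along isomorphisms of subobjects. -/
def congr (d : InverseDatum A i j) (e : X' ≅ X) (f : Y' ≅ Y) (he : e.hom ≫ i = i')
    (hf : f.hom ≫ j = j') : InverseDatum A i' j' where
  mX := (e ⊗ᵢ f) ≪≫ d.mX
  mY := (f ⊗ᵢ e) ≪≫ d.mY
  mX_unit := by simp [d.mX_unit, ← he, ← hf]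
  mY_unit := by simp [d.mY_unit, ← he, ← hf]

theorem tensor_aux (mX : X ⊗ Y ⟶ 𝟙_ C) (mX' : X' ⊗ Y' ⟶ 𝟙_ C)
    (h : mX ≫ η[A.X] = (i ⊗ₘ j) ≫ μ[A.X]) (h' : mX' ≫ η[A.X] = (i' ⊗ₘ j') ≫ μ[A.X]) :
    ((α_ X X' (Y' ⊗ Y)).hom ≫ X ◁ ((α_ X' Y' Y).inv ≫ mX' ▷ Y ≫ (λ_ Y).hom) ≫ mX) ≫ η[A.X] =
      (((i ⊗ₘ i') ≫ μ[A.X]) ⊗ₘ ((j' ⊗ₘ j) ≫ μ[A.X])) ≫ μ[A.X] := by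
  have k1 : ((α_ X' Y' Y).inv ≫ mX' ▷ Y ≫ (λ_ Y).hom) ≫ j =
      (i' ⊗ₘ ((j' ⊗ₘ j) ≫ μ[A.X])) ≫ μ[A.X] := by
    calc _ = (α_ X' Y' Y).inv ≫ ((mX' ≫ η[A.X]) ⊗ₘ j) ≫ μ[A.X] := by
            rw [MonoidalCategory.tensorHom_def_assoc, comp_whiskerRight]
            simp only [Category.assoc]
            rw [← whisker_exchange_assoc η[A.X] j, MonObj.one_mul]
            simp
      _ = _ := by
            rw [h', tensor_comp_left, Category.assoc, MonObj.mul_assoc,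
              associator_naturality_assoc, Iso.inv_hom_id_assoc, tensor_comp_right, Category.assoc]
  have k2 : X ◁ ((α_ X' Y' Y).inv ≫ mX' ▷ Y ≫ (λ_ Y).hom) ≫ (i ⊗ₘ j) =
      i ⊗ₘ ((i' ⊗ₘ ((j' ⊗ₘ j) ≫ μ[A.X])) ≫ μ[A.X]) := by
    rw [← k1]; simp [MonoidalCategory.tensorHom_def']
  rw [Category.assoc, Category.assoc, h, reassoc_of% k2, tensor_comp_left, Category.assoc,
    MonObj.mul_assoc, associator_naturality_assoc, tensor_comp_right, Category.assoc]

/-- The tensor product of invertible subobjects is invertible. -/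
def tensor (d : InverseDatum A i j) (d' : InverseDatum A i' j') :
    InverseDatum A ((i ⊗ₘ i') ≫ μ[A.X]) ((j' ⊗ₘ j) ≫ μ[A.X]) where
  mX := α_ X X' (Y' ⊗ Y) ≪≫
    whiskerLeftIso X ((α_ X' Y' Y).symm ≪≫ whiskerRightIso d'.mX Y ≪≫ λ_ Y) ≪≫ d.mX
  mY := α_ Y' Y (X ⊗ X') ≪≫
    whiskerLeftIso Y' ((α_ Y X X').symm ≪≫ whiskerRightIso d.mY X' ≪≫ λ_ X') ≪≫ d'.mY
  mX_unit := tensor_aux d.mX.hom d'.mX.hom d.mX_unit d'.mX_unit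
  mY_unit := tensor_aux d'.mY.hom d.mY.hom d'.mY_unit d.mY_unit

/-- Tensoring with an invertible object is an equivalence. -/
theorem tensorLeft_isEquivalence (d : InverseDatum A i j) : (tensorLeft X).IsEquivalence :=
  (CategoryTheory.Equivalence.mk (tensorLeft X) (tensorLeft Y)
    ((leftUnitorNatIso C).symm ≪≫ (curriedTensor C).mapIso d.mY.symm ≪≫ tensorLeftTensor Y X)
    ((tensorLeftTensor X Y).symm ≪≫ (curriedTensor C).mapIso d.mX ≪≫
      leftUnitorNatIso C)).isEquivalence_functor

theorem mono_act (d : InverseDatum A i j) : Mono (i ▷ A.X ≫ μ[A.X]) := by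
  have hY := d.symm.tensorLeft_isEquivalence
  have key : Y ◁ (i ▷ A.X ≫ μ[A.X]) ≫ (j ▷ A.X ≫ μ[A.X]) =
      (α_ Y X A.X).inv ≫ d.mY.hom ▷ A.X ≫ (λ_ A.X).hom := by
    have : d.mY.hom ▷ A.X ≫ (λ_ A.X).hom = (d.mY.hom ≫ η[A.X]) ▷ A.X ≫ μ[A.X] := by simp
    rw [this, d.mY_unit, comp_whiskerRight, Category.assoc, MonObj.mul_assoc,
      ← tensorHom_id (j ⊗ₘ i), associator_naturality_assoc, Iso.inv_hom_id_assoc, tensorHom_id,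
      MonoidalCategory.tensorHom_def', Category.assoc, whiskerLeft_comp, Category.assoc,
      whisker_exchange_assoc]
  have h2 : Mono (Y ◁ (i ▷ A.X ≫ μ[A.X]) ≫ (j ▷ A.X ≫ μ[A.X])) := by
    rw [key]; infer_instance
  have h3 : Mono ((tensorLeft Y).map (i ▷ A.X ≫ μ[A.X])) :=
    mono_of_mono (Y ◁ (i ▷ A.X ≫ μ[A.X])) (j ▷ A.X ≫ μ[A.X])
  exact (tensorLeft Y).mono_of_mono_map h3

theorem mono_tensor (d : InverseDatum A i j) [Mono i'] : Mono ((i ⊗ₘ i') ≫ μ[A.X]) := by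
  have h1 := d.tensorLeft_isEquivalence
  have h2 := d.mono_act
  have h3 : Mono (X ◁ i') := inferInstanceAs (Mono ((tensorLeft X).map i'))
  have : (i ⊗ₘ i') ≫ μ[A.X] = X ◁ i' ≫ i ▷ A.X ≫ μ[A.X] := by simp [MonoidalCategory.tensorHom_def']
  rw [this]
  exact mono_comp _ _

theorem isInvertible_mk (d : InverseDatum A i j) [Mono i] [Mono j] :
    IsInvertible (Subobject.mk i) :=
  ⟨Subobject.mk j, ⟨d.congr (Subobject.underlyingIso i) (Subobject.underlyingIso j)
    (by simp) (by simp)⟩⟩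

end InverseDatum

namespace Inv

variable {A : Mon C}

instance mono_mul (x x' : Inv A) : Mono ((x.1.arrow ⊗ₘ x'.1.arrow) ≫ μ[A.X]) :=
  (Classical.choice x.2.choose_spec).mono_tensor

/-- The product of `X` and `X'` is `X ⊗ X'` with the monomorphism `m ∘ (i_X ⊗ i_X')`. -/
instance : Mul (Inv A) where
  mul x x' :=
    ⟨Subobject.mk ((x.1.arrow ⊗ₘ x'.1.arrow) ≫ μ[A.X]), by
      obtain ⟨y, ⟨d⟩⟩ := x.2
      obtain ⟨y', ⟨d'⟩⟩ := x'.2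
      have := d'.symm.mono_tensor (i' := y.arrow)
      exact (d.tensor d').isInvertible_mk⟩

/-- The neutral element is `𝟙` with the monomorphism `u`. -/
instance [Mono η[A.X]] : One (Inv A) where
  one := ⟨Subobject.mk η[A.X], (InverseDatum.unit A).isInvertible_mk⟩

/-- The inverse of an invertible subobject is any two-sided inverse of it. -/
instance : _root_.Inv (Inv A) where
  inv x := ⟨x.2.choose, ⟨x.1, ⟨(Classical.choice x.2.choose_spec).symm⟩⟩⟩

theorem mk_tensor_eq {X X' : C} {x x' : Inv A} (i : X ⟶ A.X) (i' : X' ⟶ A.X) [Mono i] [Mono i']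
    [Mono ((i ⊗ₘ i') ≫ μ[A.X])] (h : x.1 = Subobject.mk i) (h' : x'.1 = Subobject.mk i') :
    (x * x').1 = Subobject.mk ((i ⊗ₘ i') ≫ μ[A.X]) := by
  refine Subobject.mk_eq_mk_of_comm _ _
    ((Subobject.isoOfEqMk _ i h) ⊗ᵢ (Subobject.isoOfEqMk _ i' h')) ?_
  simp

instance [Mono η[A.X]] : Group (Inv A) :=
  Group.ofLeftAxioms
    (by
      intro a b c
      have h1 : Mono ((((a.1.arrow ⊗ₘ b.1.arrow) ≫ μ[A.X]) ⊗ₘ c.1.arrow) ≫ μ[A.X]) := by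
        obtain ⟨y, ⟨d⟩⟩ := a.2
        obtain ⟨y', ⟨d'⟩⟩ := b.2
        exact (d.tensor d').mono_tensor
      have h2 : Mono ((a.1.arrow ⊗ₘ ((b.1.arrow ⊗ₘ c.1.arrow) ≫ μ[A.X])) ≫ μ[A.X]) := by
        obtain ⟨y, ⟨d⟩⟩ := a.2
        exact d.mono_tensor
      apply Subtype.ext
      rw [mk_tensor_eq (x := a * b) (x' := c) ((a.1.arrow ⊗ₘ b.1.arrow) ≫ μ[A.X]) c.1.arrow rfl
          (by simp),
        mk_tensor_eq (x := a) (x' := b * c) a.1.arrow ((b.1.arrow ⊗ₘ c.1.arrow) ≫ μ[A.X])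
          (by simp) rfl]
      refine Subobject.mk_eq_mk_of_comm _ _ (α_ _ _ _) ?_
      rw [tensor_comp_left, Category.assoc, MonObj.mul_assoc, associator_naturality_assoc,
        tensor_comp_right, Category.assoc])
    (by
      intro a
      have h1 : Mono ((η[A.X] ⊗ₘ a.1.arrow) ≫ μ[A.X]) := (InverseDatum.unit A).mono_tensor
      apply Subtype.ext
      rw [mk_tensor_eq (x := 1) (x' := a) η[A.X] a.1.arrow rfl (by simp)]
      exact Subobject.mk_eq_of_comm _ (λ_ _) (by simp [MonoidalCategory.tensorHom_def']))
    (by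
      intro a
      apply Subtype.ext
      exact Subobject.mk_eq_mk_of_comm _ _ (Classical.choice a.2.choose_spec).mY
        (Classical.choice a.2.choose_spec).mY_unit)

end Inv

/-- `Φ_X(t) = m ∘ (i_X ⊗ (t ▷ i_Y)) ∘ m_X⁻¹`, the Miyashita action of an invertible subobject `X`
with inverse `Y`. -/
def miyashita {A : Mon C} {X Y : C} {i : X ⟶ A.X} {j : Y ⟶ A.X} (d : InverseDatum A i j)
    (t : ZObj A) : ZObj A :=
  d.mX.inv ≫ (i ⊗ₘ triLeft (Bimod.regular A) t j) ≫ μ[A.X]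

/-- `Γ_X : A ≅ A ⊗ X ⊗ Y ⟶ X ⊗ A ⊗ Y ⟶ A ⊗ A ⊗ A ⟶ A`, for an invertible subobject `X` with
inverse `Y`. -/
def gamma [SymmetricCategory C] {A : Mon C} {X Y : C} {i : X ⟶ A.X} {j : Y ⟶ A.X}
    (d : InverseDatum A i j) : A.X ⟶ A.X :=
  (ρ_ A.X).inv ≫ A.X ◁ d.mX.inv ≫ (α_ A.X X Y).inv ≫ (β_ A.X X).hom ▷ Y ≫
    (α_ X A.X Y).hom ≫ (i ⊗ₘ (𝟙 A.X ⊗ₘ j)) ≫ A.X ◁ μ[A.X] ≫ μ[A.X]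

end Inv

/-! ### Azumaya monoids -/

section Azumaya

variable {C : Type u} [Category.{v} C] [MonoidalCategory C]

/-- `A ⊗ A` with its outer `A`-bimodule structure `a (x ⊗ y) b = a x ⊗ y b`. -/
@[simps]
def outer (A : Mon C) : Bimod A A where
  X := A.X ⊗ A.X
  actLeft := (α_ A.X A.X A.X).inv ≫ μ[A.X] ▷ A.X
  actRight := (α_ A.X A.X A.X).hom ≫ A.X ◁ μ[A.X]
  one_actLeft := by simp [← comp_whiskerRight]
  left_assoc := by
    have : (μ[A.X] ▷ A.X) ▷ A.X ≫ μ[A.X] ▷ A.X = (α_ A.X A.X A.X).hom ▷ A.X ≫ (A.X ◁ μ[A.X]) ▷ A.X ≫ μ[A.X] ▷ A.X := by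
      simp only [← comp_whiskerRight, MonObj.mul_assoc]
    rw [associator_inv_naturality_left_assoc, this]
    monoidal
  actRight_one := by simp [← whiskerLeft_comp]
  right_assoc := by
    have : A.X ◁ (A.X ◁ μ[A.X]) ≫ A.X ◁ μ[A.X] = A.X ◁ (α_ A.X A.X A.X).inv ≫ A.X ◁ (μ[A.X] ▷ A.X) ≫ A.X ◁ μ[A.X] := by
      simp only [← whiskerLeft_comp, MonObj.mul_assoc, Iso.inv_hom_id_assoc]
    rw [associator_naturality_right_assoc, this]
    monoidal
  middle_assoc := by
    have : (μ[A.X] ▷ (A.X ⊗ A.X)) ≫ A.X ◁ μ[A.X] = (A.X ⊗ A.X) ◁ μ[A.X] ≫ μ[A.X] ▷ A.X := by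
      rw [whisker_exchange]
    rw [comp_whiskerRight, Category.assoc, associator_naturality_left_assoc, this]
    monoidal

/-- The multiplication of `A`, as a morphism of `A`-bimodules `A ⊗ A ⟶ A`. -/
def mulHom (A : Mon C) : outer A ⟶ Bimod.regular A where
  hom := μ[A.X]
  left_act_hom := by
    change ((α_ A.X A.X A.X).inv ≫ μ[A.X] ▷ A.X) ≫ μ[A.X] = A.X ◁ μ[A.X] ≫ μ[A.X]
    simp
  right_act_hom := by
    change ((α_ A.X A.X A.X).hom ≫ A.X ◁ μ[A.X]) ≫ μ[A.X] = μ[A.X] ▷ A.X ≫ μ[A.X]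
    simp

variable [SymmetricCategory C]

/-- The functor `A ⊗ -` from `C` to `A`-bimodules (equivalently, left modules over the enveloping
monoid `A ⊗ Aᵒ`): the bimodule `A ⊗ X` has left action by multiplication on `A` and right
action `A ⊗ X ⊗ A ≅ A ⊗ A ⊗ X ⟶ A ⊗ X`. -/
def tensorBimod (A : Mon C) : C ⥤ Bimod A A where
  obj X :=
    { X := A.X ⊗ X
      actLeft := (α_ A.X A.X X).inv ≫ μ[A.X] ▷ X
      actRight := (α_ A.X X A.X).hom ≫ A.X ◁ (β_ X A.X).hom ≫ (α_ A.X A.X X).inv ≫ μ[A.X] ▷ X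
      one_actLeft := by simp [← comp_whiskerRight]
      left_assoc := by
        have : (μ[A.X] ▷ A.X) ▷ X ≫ μ[A.X] ▷ X = (α_ A.X A.X A.X).hom ▷ X ≫ (A.X ◁ μ[A.X]) ▷ X ≫ μ[A.X] ▷ X := by
          simp only [← comp_whiskerRight, MonObj.mul_assoc]
        rw [associator_inv_naturality_left_assoc, this]
        monoidal
      actRight_one := by
        have : (A.X ◁ η[A.X]) ▷ X ≫ μ[A.X] ▷ X = (ρ_ A.X).hom ▷ X := by
          simp only [← comp_whiskerRight, MonObj.mul_one]
        rw [associator_naturality_right_assoc, ← whiskerLeft_comp_assoc,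
          BraidedCategory.braiding_naturality_right, whiskerLeft_comp_assoc,
          associator_inv_naturality_middle_assoc, this]
        simp
      right_assoc := by
        have : (μ[A.X] ▷ A.X) ▷ X ≫ μ[A.X] ▷ X = (α_ A.X A.X A.X).hom ▷ X ≫ (A.X ◁ μ[A.X]) ▷ X ≫ μ[A.X] ▷ X := by
          simp only [← comp_whiskerRight, MonObj.mul_assoc]
        rw [associator_naturality_right_assoc, ← whiskerLeft_comp_assoc,
          BraidedCategory.braiding_naturality_right, whiskerLeft_comp_assoc,
          associator_inv_naturality_middle_assoc, BraidedCategory.braiding_tensor_right_hom]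
        simp only [comp_whiskerRight, Category.assoc]
        rw [associator_naturality_left_assoc, ← whisker_exchange_assoc,
          associator_inv_naturality_left_assoc, this]
        monoidal
      middle_assoc := by
        have : (μ[A.X] ▷ A.X) ▷ X ≫ μ[A.X] ▷ X = (α_ A.X A.X A.X).hom ▷ X ≫ (A.X ◁ μ[A.X]) ▷ X ≫ μ[A.X] ▷ X := by
          simp only [← comp_whiskerRight, MonObj.mul_assoc]
        simp only [comp_whiskerRight, Category.assoc]
        rw [associator_naturality_left_assoc, ← whisker_exchange_assoc,
          associator_inv_naturality_left_assoc, this]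
        monoidal }
  map f :=
    { hom := A.X ◁ f
      left_act_hom := by
        dsimp only
        rw [Category.assoc, ← whisker_exchange, associator_inv_naturality_right_assoc]
      right_act_hom := by
        dsimp only
        simp only [Category.assoc]
        rw [← whisker_exchange, associator_naturality_middle_assoc,
          ← associator_inv_naturality_right_assoc, ← whiskerLeft_comp_assoc,
          ← whiskerLeft_comp_assoc, BraidedCategory.braiding_naturality_left] }
  map_id X := by ext; exact whiskerLeft_id _ _
  map_comp f g := by ext; exact whiskerLeft_comp _ _ _

/-- `A` is an Azumaya monoid: `A ⊗ -` is an equivalence from `C` to the category of `A`-bimodules,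
and the multiplication of `A` splits as a morphism of `A`-bimodules. -/
class IsAzumaya (A : Mon C) : Prop where
  isEquivalence : (tensorBimod A).IsEquivalence
  splits : ∃ s : Bimod.regular A ⟶ outer A, s ≫ mulHom A = 𝟙 _

/-- The unit of an Azumaya monoid is a monomorphism. -/
instance (A : Mon C) [h : IsAzumaya A] : Mono η[A.X] where
  right_cancellation {K} f g hfg := by
    have := h.isEquivalence
    apply (tensorBimod A).map_injective
    ext
    change A.X ◁ f = A.X ◁ g
    rw [← cancel_mono (ρ_ A.X).hom, ← MonObj.mul_one A.X, ← whiskerLeft_comp_assoc,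
      ← whiskerLeft_comp_assoc, hfg]

end Azumaya

/-! ### Divisibility of (twisted) bimodules, and the set `H` -/

section Divides

variable {C : Type u} [Category.{v} C] [Preadditive C] [MonoidalCategory C] {A : Mon C}

/-- `M | N`: the bimodule `M` is a direct summand of a finite direct sum of copies of `N`. -/
def Divides (M N : Bimod A A) : Prop :=
  ∃ k : ℕ, 1 ≤ k ∧ ∃ (f : Fin k → (M ⟶ N)) (g : Fin k → (N ⟶ M)),
    ∑ l, (f l).hom ≫ (g l).hom = 𝟙 M.X

/-- Membership in the set of morphisms `M_σ ⟶ N_τ`: left `A`-linear `f : M ⟶ N` such that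
`f ∘ (M ◁ σ(z)) = f ◁ τ(z)` for all `z ∈ Z(A)`. -/
def IsTwistedHom (M : Bimod A A) (σ : ZObj A → ZObj A) (N : Bimod A A) (τ : ZObj A → ZObj A)
    (f : M.X ⟶ N.X) : Prop :=
  M.actLeft ≫ f = A.X ◁ f ≫ N.actLeft ∧
    ∀ z : ZObj A, triRight M (𝟙 M.X) (σ z) ≫ f = triRight N f (τ z)

/-- `M_σ | N_τ`. -/
def TwistedDivides (M : Bimod A A) (σ : ZObj A → ZObj A) (N : Bimod A A)
    (τ : ZObj A → ZObj A) : Prop :=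
  ∃ k : ℕ, 1 ≤ k ∧ ∃ (f : Fin k → (M.X ⟶ N.X)) (g : Fin k → (N.X ⟶ M.X)),
    (∀ l, IsTwistedHom M σ N τ (f l)) ∧ (∀ l, IsTwistedHom N τ M σ (g l)) ∧
      ∑ l, f l ≫ g l = 𝟙 M.X

variable [MonoidalPreadditive C]

/-- The set `H(Z(A))` of the algebra automorphisms `θ` of `Z(A)` with `A_θ ∼ A_1`. -/
def setH (A : Mon C) : Set (AutZ A) :=
  {θ | TwistedDivides (Bimod.regular A) θ (Bimod.regular A) id ∧
    TwistedDivides (Bimod.regular A) id (Bimod.regular A) θ}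

end Divides

/-! ### The invariant subobjects `J σ δ`, and the set `G` -/

section Invariants

variable {C : Type u} [Category.{v} C] [MonoidalCategory C]

/-- `t ▷ A : A ⟶ A`, left multiplication by `t ∈ Z(A)`. -/
def lMul {A : Mon C} (t : ZObj A) : A.X ⟶ A.X := triLeft (Bimod.regular A) t (𝟙 A.X)

/-- `A ◁ t : A ⟶ A`, right multiplication by `t ∈ Z(A)`. -/
def rMul {A : Mon C} (t : ZObj A) : A.X ⟶ A.X := triRight (Bimod.regular A) (𝟙 A.X) t

theorem mul_lMul {A : Mon C} (t : ZObj A) : μ[A.X] ≫ lMul t = lMul t ▷ A.X ≫ μ[A.X] := by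
  have h (s : 𝟙_ C ⟶ A.X) : μ[A.X] ≫ (λ_ A.X).inv ≫ (s ⊗ₘ 𝟙 A.X) ≫ μ[A.X] =
      ((λ_ A.X).inv ≫ (s ⊗ₘ 𝟙 A.X) ≫ μ[A.X]) ▷ A.X ≫ μ[A.X] := by
    simp only [tensorHom_id, comp_whiskerRight, Category.assoc, MonObj.mul_assoc]
    rw [associator_naturality_left_assoc, ← whisker_exchange_assoc,
      leftUnitor_inv_naturality_assoc]
    simp
  exact h t

theorem mul_rMul {A : Mon C} (t : ZObj A) : μ[A.X] ≫ rMul t = A.X ◁ rMul t ≫ μ[A.X] := by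
  have h (s : 𝟙_ C ⟶ A.X) : μ[A.X] ≫ (ρ_ A.X).inv ≫ (𝟙 A.X ⊗ₘ s) ≫ μ[A.X] =
      A.X ◁ ((ρ_ A.X).inv ≫ (𝟙 A.X ⊗ₘ s) ≫ μ[A.X]) ≫ μ[A.X] := by
    simp only [id_tensorHom, whiskerLeft_comp, Category.assoc, MonObj.mul_assoc_flip]
    rw [associator_inv_naturality_right_assoc, whisker_exchange_assoc,
      rightUnitor_inv_naturality_assoc]
    simp
  exact h t

theorem rMul_mul {A : Mon C} (t : ZObj A) : rMul t ▷ A.X ≫ μ[A.X] = A.X ◁ lMul t ≫ μ[A.X] := by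
  have h (s : 𝟙_ C ⟶ A.X) : ((ρ_ A.X).inv ≫ (𝟙 A.X ⊗ₘ s) ≫ μ[A.X]) ▷ A.X ≫ μ[A.X] =
      A.X ◁ ((λ_ A.X).inv ≫ (s ⊗ₘ 𝟙 A.X) ≫ μ[A.X]) ≫ μ[A.X] := by
    simp only [whiskerLeft_comp, comp_whiskerRight, Category.assoc, MonObj.mul_assoc,
      id_tensorHom, tensorHom_id]
    simp
  exact h t

variable [Abelian C] [WellPowered.{v} C] [HasLimits C]

/-- The intersection over all `t ∈ Z(A)` of the equalizers of `σ(t) ▷ A` and `A ◁ δ(t)`. -/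
def J (A : Mon C) (σ δ : ZObj A → ZObj A) : Subobject A.X :=
  Subobject.sInf.{v} (Set.range fun t : ZObj A =>
    equalizerSubobject (lMul (σ t))
      (rMul (δ t)))

theorem J_factors_iff {A : Mon C} {σ δ : ZObj A → ZObj A} {W : C} (f : W ⟶ A.X) :
    (J.{v, u} A σ δ).Factors f ↔ ∀ t, f ≫ lMul (σ t) =
      f ≫ rMul (δ t) := by
  constructor
  · intro h t
    exact (equalizerSubobject_factors_iff _ _ _).1
      (Subobject.factors_of_le f (Subobject.sInf_le.{v} _ _ (Set.mem_range_self t)) h)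
  · intro h
    have : imageSubobject f ≤ J.{v, u} A σ δ := by
      refine Subobject.le_sInf.{v} _ _ ?_
      rintro _ ⟨t, rfl⟩
      exact imageSubobject_le _ ((equalizerSubobject _ _).factorThru f
        ((equalizerSubobject_factors_iff _ _ _).2 (h t))) (by simp)
    have h2 := Subobject.factors_comp_arrow (P := imageSubobject f) (factorThruImageSubobject f)
    rw [imageSubobject_arrow_comp] at h2
    exact Subobject.factors_of_le f this h2

theorem J_condition (A : Mon C) (σ δ : ZObj A → ZObj A) (t : ZObj A) :
    (J.{v, u} A σ δ).arrow ≫ lMul (σ t) =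
      (J.{v, u} A σ δ).arrow ≫ rMul (δ t) :=
  (J_factors_iff _).1 (Subobject.factors_self _) t

/-- The morphism `J σ δ ⊗ J δ τ ⟶ J σ τ` induced by the multiplication of `A`. -/
def jMul (A : Mon C) (σ δ τ : ZObj A → ZObj A) :
    (J.{v, u} A σ δ : C) ⊗ (J.{v, u} A δ τ : C) ⟶ (J.{v, u} A σ τ : C) :=
  (J.{v, u} A σ τ).factorThru
    (((J.{v, u} A σ δ).arrow ⊗ₘ (J.{v, u} A δ τ).arrow) ≫ μ[A.X]) (by
      rw [J_factors_iff]
      intro t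
      have e1 : ((J.{v, u} A σ δ).arrow ⊗ₘ (J.{v, u} A δ τ).arrow) ≫
          lMul (σ t) ▷ A.X =
          ((J.{v, u} A σ δ).arrow ⊗ₘ (J.{v, u} A δ τ).arrow) ≫
            rMul (δ t) ▷ A.X := by
        rw [← tensor_comp_left, J_condition, tensor_comp_left]
      have e2 : ((J.{v, u} A σ δ).arrow ⊗ₘ (J.{v, u} A δ τ).arrow) ≫
          A.X ◁ lMul (δ t) =
          ((J.{v, u} A σ δ).arrow ⊗ₘ (J.{v, u} A δ τ).arrow) ≫
            A.X ◁ rMul (τ t) := by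
        rw [← tensor_comp_right, J_condition, tensor_comp_right]
      rw [Category.assoc, Category.assoc, mul_lMul, mul_rMul, reassoc_of% e1,
        rMul_mul, reassoc_of% e2])

theorem jMul_arrow (A : Mon C) (σ δ τ : ZObj A → ZObj A) :
    jMul A σ δ τ ≫ (J.{v, u} A σ τ).arrow =
      ((J.{v, u} A σ δ).arrow ⊗ₘ (J.{v, u} A δ τ).arrow) ≫ μ[A.X] :=
  Subobject.factorThru_arrow _ _ _

theorem jMul_assoc (A : Mon C) (σ δ τ κ : ZObj A → ZObj A) :
    jMul A σ δ τ ▷ (J.{v, u} A τ κ : C) ≫ jMul A σ τ κ =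
      (α_ _ _ _).hom ≫ (J.{v, u} A σ δ : C) ◁ jMul A δ τ κ ≫ jMul A σ δ κ := by
  rw [← cancel_mono (J.{v, u} A σ κ).arrow, Category.assoc, Category.assoc, Category.assoc,
    jMul_arrow, jMul_arrow]
  have e1 : jMul A σ δ τ ▷ (J.{v, u} A τ κ : C) ≫
      ((J.{v, u} A σ τ).arrow ⊗ₘ (J.{v, u} A τ κ).arrow) =
      ((((J.{v, u} A σ δ).arrow ⊗ₘ (J.{v, u} A δ τ).arrow) ≫ μ[A.X]) ⊗ₘ
        (J.{v, u} A τ κ).arrow) := by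
    rw [← jMul_arrow, ← tensorHom_id, tensorHom_comp_tensorHom, Category.id_comp]
  have e2 : (J.{v, u} A σ δ : C) ◁ jMul A δ τ κ ≫
      ((J.{v, u} A σ δ).arrow ⊗ₘ (J.{v, u} A δ κ).arrow) =
      ((J.{v, u} A σ δ).arrow ⊗ₘ
        (((J.{v, u} A δ τ).arrow ⊗ₘ (J.{v, u} A τ κ).arrow) ≫ μ[A.X])) := by
    rw [← jMul_arrow, ← id_tensorHom, tensorHom_comp_tensorHom, Category.id_comp]
  rw [reassoc_of% e1, reassoc_of% e2, tensor_comp_left, Category.assoc, MonObj.mul_assoc,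
    associator_naturality_assoc, tensor_comp_right, Category.assoc]

variable [HasColimits C]

/-- The tensor product of `J σ δ` and `J δ τ` over the monoid `J δ δ`. -/
def jTensor (A : Mon C) (σ δ τ : ZObj A → ZObj A) : C :=
  coequalizer (jMul A σ δ δ ▷ (J.{v, u} A δ τ : C))
    ((α_ _ _ _).hom ≫ (J.{v, u} A σ δ : C) ◁ jMul A δ δ τ)

/-- The morphism out of the tensor product over `J δ δ` induced by `J σ δ ⊗ J δ τ ⟶ J σ τ`. -/
def jMulBar (A : Mon C) (σ δ τ : ZObj A → ZObj A) :
    jTensor A σ δ τ ⟶ (J.{v, u} A σ τ : C) :=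
  coequalizer.desc (jMul A σ δ τ) (by rw [jMul_assoc, Category.assoc])

/-- The set `G(Z(A))` of the algebra automorphisms `θ` of `Z(A)` such that `J θ 1` is a two-sided
invertible subobject, with inverse `J 1 θ` (over the monoid `J 1 1 = J θ θ`). -/
def setG [MonoidalPreadditive C] (A : Mon C) : Set (AutZ A) :=
  {θ | IsIso (jMulBar A θ id θ) ∧ IsIso (jMulBar A id θ id)}

end Invariants

end

end AzumayaMonoid

/-! Faithfulness of `Hom(𝟙, -)` lets morphisms be compared on global elements, and a right adjoint
of `X ⊗ -` extends this to pure tensors on `X ⊗ W` (`hom_ext_pureTensor`). Most of the argument is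
therefore ordinary algebra with words in `Z(A)`.

The Azumaya hypothesis enters twice. Fullness of `A ⊗ -` shows that a morphism into `A` commuting
with all global elements factors through the unit (`exists_factor_unit`). Hence `J δ δ` is the unit
subobject for surjective `δ`, and tensoring over it is plain tensoring. The bimodule splitting of
the multiplication is used for `twistedDivides_map`.

For an invertible `X` with inverse `Y`, products `y x` are scalars, so `Φ_X(t) = ∑ x t y` is the
only `s` with `s x = x t` for all `x` in `X` (`conj_eq`). This makes `Φ_X` multiplicative,
compatible with products in `Inv`, and independent of the inverse chosen. On global elements `Γ_X`
is `Φ_X`, so `Γ_X` is a monoid automorphism and `Ω ∘ Γ = Φ`. Moreover `X` is recovered from `Φ_X` as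
`J Φ_X 1` (`mk_eq_J`), whence `Γ` is injective.

The rest is the cycle `H ⊆ G ⊆ range Ω ⊆ H`. `H ⊆ G`: a similarity between `A_θ` and `A_1` amounts
to elements with `∑ a_l b_l = 1`, which serve as a dual basis inverting the multiplication `J θ 1 ⊗
J 1 θ ⟶ 𝟙` (`isIso_of_sum_mulZ`). `G ⊆ range Ω`: for `θ` in `G` the subobject `J θ 1` is invertible
and its Miyashita action is `θ`, so `θ = Ω(Γ_X)` with `X = J θ 1`. `range Ω ⊆ H`: the separability
element and the decomposition of `A ⊗ A` yield explicit elements `a_l`, `b_l` for any endomorphism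
of the monoid (`twistedDivides_map`). So `G` is the range of the injective homomorphism `Ω`, and the
cycle also gives surjectivity of `Γ`. -/

namespace AzumayaMonoid

open MonObj

/-! ### Pure tensors and the product of global elements -/

section PureTensors

variable {C : Type u} [Category.{v} C] [MonoidalCategory C]

/-- The pure tensor of two global elements. -/
def pureTensor {X Y : C} (s : 𝟙_ C ⟶ X) (t : 𝟙_ C ⟶ Y) : 𝟙_ C ⟶ X ⊗ Y :=
  (λ_ (𝟙_ C)).inv ≫ (s ⊗ₘ t)

-- With the simp lemmas that follow, a composite of structural morphisms evaluated on pure tensors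
-- reduces to a product of global elements.
@[simp]
theorem pureTensor_tensorHom {X Y X' Y' : C} (s : 𝟙_ C ⟶ X) (t : 𝟙_ C ⟶ Y) (f : X ⟶ X')
    (g : Y ⟶ Y') : pureTensor s t ≫ (f ⊗ₘ g) = pureTensor (s ≫ f) (t ≫ g) := by
  simp [pureTensor]

@[simp]
theorem pureTensor_tensorHom_assoc {X Y X' Y' Z : C} (s : 𝟙_ C ⟶ X) (t : 𝟙_ C ⟶ Y) (f : X ⟶ X')
    (g : Y ⟶ Y') (h : X' ⊗ Y' ⟶ Z) :
    pureTensor s t ≫ (f ⊗ₘ g) ≫ h = pureTensor (s ≫ f) (t ≫ g) ≫ h := by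
  rw [← Category.assoc, pureTensor_tensorHom]

@[simp]
theorem pureTensor_whiskerRight {X Y X' : C} (s : 𝟙_ C ⟶ X) (t : 𝟙_ C ⟶ Y) (f : X ⟶ X') :
    pureTensor s t ≫ f ▷ Y = pureTensor (s ≫ f) t := by
  rw [← tensorHom_id, pureTensor_tensorHom, Category.comp_id]

@[simp]
theorem pureTensor_whiskerRight_assoc {X Y X' Z : C} (s : 𝟙_ C ⟶ X) (t : 𝟙_ C ⟶ Y) (f : X ⟶ X')
    (h : X' ⊗ Y ⟶ Z) : pureTensor s t ≫ f ▷ Y ≫ h = pureTensor (s ≫ f) t ≫ h := by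
  rw [← Category.assoc, pureTensor_whiskerRight]

@[simp]
theorem pureTensor_whiskerLeft {X Y Y' : C} (s : 𝟙_ C ⟶ X) (t : 𝟙_ C ⟶ Y) (g : Y ⟶ Y') :
    pureTensor s t ≫ X ◁ g = pureTensor s (t ≫ g) := by
  rw [← id_tensorHom, pureTensor_tensorHom, Category.comp_id]

@[simp]
theorem pureTensor_whiskerLeft_assoc {X Y Y' Z : C} (s : 𝟙_ C ⟶ X) (t : 𝟙_ C ⟶ Y) (g : Y ⟶ Y')
    (h : X ⊗ Y' ⟶ Z) : pureTensor s t ≫ X ◁ g ≫ h = pureTensor s (t ≫ g) ≫ h := by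
  rw [← Category.assoc, pureTensor_whiskerLeft]

@[simp]
theorem pureTensor_associator_hom {X Y Z : C} (s : 𝟙_ C ⟶ X) (t : 𝟙_ C ⟶ Y) (r : 𝟙_ C ⟶ Z) :
    pureTensor (pureTensor s t) r ≫ (α_ X Y Z).hom = pureTensor s (pureTensor t r) := by
  simp only [pureTensor, MonoidalCategory.tensorHom_def]
  monoidal

@[simp]
theorem pureTensor_associator_hom_assoc {X Y Z W : C} (s : 𝟙_ C ⟶ X) (t : 𝟙_ C ⟶ Y)
    (r : 𝟙_ C ⟶ Z) (h : X ⊗ Y ⊗ Z ⟶ W) :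
    pureTensor (pureTensor s t) r ≫ (α_ X Y Z).hom ≫ h = pureTensor s (pureTensor t r) ≫ h := by
  rw [← Category.assoc, pureTensor_associator_hom]

@[simp]
theorem pureTensor_associator_inv {X Y Z : C} (s : 𝟙_ C ⟶ X) (t : 𝟙_ C ⟶ Y) (r : 𝟙_ C ⟶ Z) :
    pureTensor s (pureTensor t r) ≫ (α_ X Y Z).inv = pureTensor (pureTensor s t) r := by
  rw [← pureTensor_associator_hom_assoc, Iso.hom_inv_id, Category.comp_id]

@[simp]
theorem pureTensor_associator_inv_assoc {X Y Z W : C} (s : 𝟙_ C ⟶ X) (t : 𝟙_ C ⟶ Y)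
    (r : 𝟙_ C ⟶ Z) (h : (X ⊗ Y) ⊗ Z ⟶ W) :
    pureTensor s (pureTensor t r) ≫ (α_ X Y Z).inv ≫ h = pureTensor (pureTensor s t) r ≫ h := by
  rw [← Category.assoc, pureTensor_associator_inv]

@[simp]
theorem pureTensor_braiding [BraidedCategory C] {X Y : C} (s : 𝟙_ C ⟶ X) (t : 𝟙_ C ⟶ Y) :
    pureTensor s t ≫ (β_ X Y).hom = pureTensor t s := by
  simp [pureTensor, BraidedCategory.braiding_naturality, unitors_inv_equal]

@[simp]
theorem comp_leftUnitor_inv_whiskerRight {X Y : C} (s : 𝟙_ C ⟶ X) (t : 𝟙_ C ⟶ Y) :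
    t ≫ (λ_ Y).inv ≫ s ▷ Y = pureTensor s t := by
  simp [pureTensor, MonoidalCategory.tensorHom_def']

@[simp]
theorem comp_leftUnitor_inv_whiskerRight_assoc {X Y Z : C} (s : 𝟙_ C ⟶ X) (t : 𝟙_ C ⟶ Y)
    (h : X ⊗ Y ⟶ Z) : t ≫ (λ_ Y).inv ≫ s ▷ Y ≫ h = pureTensor s t ≫ h := by
  rw [← comp_leftUnitor_inv_whiskerRight, Category.assoc, Category.assoc]

@[simp]
theorem comp_rightUnitor_inv_whiskerLeft {X Y : C} (s : 𝟙_ C ⟶ X) (t : 𝟙_ C ⟶ Y) :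
    s ≫ (ρ_ X).inv ≫ X ◁ t = pureTensor s t := by
  simp [pureTensor, MonoidalCategory.tensorHom_def, unitors_inv_equal]

@[simp]
theorem comp_rightUnitor_inv_whiskerLeft_assoc {X Y Z : C} (s : 𝟙_ C ⟶ X) (t : 𝟙_ C ⟶ Y)
    (h : X ⊗ Y ⟶ Z) : s ≫ (ρ_ X).inv ≫ X ◁ t ≫ h = pureTensor s t ≫ h := by
  rw [← comp_rightUnitor_inv_whiskerLeft, Category.assoc, Category.assoc]

/-- The product of two global elements of a monoid. -/
def mulZ {A : Mon C} (s t : 𝟙_ C ⟶ A.X) : 𝟙_ C ⟶ A.X := pureTensor s t ≫ μ[A.X]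

@[simp]
theorem pureTensor_mul {A : Mon C} (s t : 𝟙_ C ⟶ A.X) : pureTensor s t ≫ μ[A.X] = mulZ s t := rfl

@[simp]
theorem pureTensor_mul_assoc {A : Mon C} (s t : 𝟙_ C ⟶ A.X) {Z : C} (f : A.X ⟶ Z) :
    pureTensor s t ≫ μ[A.X] ≫ f = mulZ s t ≫ f := (Category.assoc _ _ _).symm

variable {A : Mon C}

theorem mulZ_eq (s t : 𝟙_ C ⟶ A.X) : mulZ s t = (λ_ (𝟙_ C)).inv ≫ (s ⊗ₘ t) ≫ μ[A.X] :=
  Category.assoc _ _ _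

@[simp]
theorem one_mulZ (s : 𝟙_ C ⟶ A.X) : mulZ η s = s := by
  rw [mulZ_eq]; exact one_conv s

@[simp]
theorem mulZ_one (s : 𝟙_ C ⟶ A.X) : mulZ s η = s := by
  rw [mulZ_eq]; exact conv_one s

@[simp]
theorem mulZ_assoc (s t r : 𝟙_ C ⟶ A.X) : mulZ (mulZ s t) r = mulZ s (mulZ t r) := by
  simp only [mulZ_eq]; exact conv_assoc s t r

theorem scalar_mulZ (k : 𝟙_ C ⟶ 𝟙_ C) (s : 𝟙_ C ⟶ A.X) : mulZ (k ≫ η) s = k ≫ s := by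
  rw [mulZ_eq]; exact unit_conv k s

theorem mulZ_scalar (k : 𝟙_ C ⟶ 𝟙_ C) (s : 𝟙_ C ⟶ A.X) : mulZ s (k ≫ η) = k ≫ s := by
  rw [mulZ_eq]; exact conv_unit k s

@[simp]
theorem mulZ_map {B : Mon C} (f : A ⟶ B) (s t : 𝟙_ C ⟶ A.X) :
    mulZ s t ≫ f.hom = mulZ (s ≫ f.hom) (t ≫ f.hom) := by
  simp only [mulZ_eq]; exact conv_map f s t

/-- Left multiplication by a global element. -/
def leftMul (t : 𝟙_ C ⟶ A.X) : A.X ⟶ A.X := lMul (A := A) t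

/-- Right multiplication by a global element. -/
def rightMul (t : 𝟙_ C ⟶ A.X) : A.X ⟶ A.X := rMul (A := A) t

theorem leftMul_eq (t : 𝟙_ C ⟶ A.X) : leftMul t = (λ_ A.X).inv ≫ t ▷ A.X ≫ μ[A.X] := by
  rw [← tensorHom_id]; rfl

theorem rightMul_eq (t : 𝟙_ C ⟶ A.X) : rightMul t = (ρ_ A.X).inv ≫ A.X ◁ t ≫ μ[A.X] := by
  rw [← id_tensorHom]; rfl

@[simp]
theorem comp_leftMul (s t : 𝟙_ C ⟶ A.X) : s ≫ leftMul t = mulZ t s := by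
  rw [leftMul_eq, comp_leftUnitor_inv_whiskerRight_assoc]; rfl

@[simp]
theorem comp_rightMul (s t : 𝟙_ C ⟶ A.X) : s ≫ rightMul t = mulZ s t := by
  rw [rightMul_eq, comp_rightUnitor_inv_whiskerLeft_assoc]; rfl

@[simp]
theorem comp_rightMul_assoc (s t : 𝟙_ C ⟶ A.X) {Z : C} (h : A.X ⟶ Z) :
    s ≫ rightMul t ≫ h = mulZ s t ≫ h := by
  rw [← Category.assoc, comp_rightMul]

@[simp]
theorem rightMul_one : rightMul (η[A.X] : 𝟙_ C ⟶ A.X) = 𝟙 A.X := by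
  simp [rightMul_eq]

theorem mul_rightMul (t : 𝟙_ C ⟶ A.X) : μ[A.X] ≫ rightMul t = A.X ◁ rightMul t ≫ μ[A.X] :=
  mul_rMul (A := A) t

theorem rightMul_comp_rightMul (s t : 𝟙_ C ⟶ A.X) :
    rightMul s ≫ rightMul t = rightMul (mulZ s t) := by
  rw [rightMul_eq s, Category.assoc, Category.assoc, mul_rightMul, ← whiskerLeft_comp_assoc,
    comp_rightMul, ← rightMul_eq]

end PureTensors

/-! ### Testing morphisms on global elements -/

section Separation

variable {C : Type u} [Category.{v} C] [MonoidalCategory C] [Preadditive C]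

theorem hom_ext_elements (hZ : (preadditiveCoyonedaObj (𝟙_ C)).Faithful) {X Y : C} {f g : X ⟶ Y}
    (h : ∀ x : 𝟙_ C ⟶ X, x ≫ f = x ≫ g) : f = g := by
  apply (preadditiveCoyonedaObj (𝟙_ C)).map_injective
  ext x
  exact h x

/-- Transposing across the adjunction turns the second variable into a morphism out of `W`, which is
tested on elements `w`. Transposing back leaves a morphism out of `X`, tested on elements `x`. Only
the left factor needs the adjoint. -/
theorem hom_ext_pureTensor (hZ : (preadditiveCoyonedaObj (𝟙_ C)).Faithful) {X W N : C}
    (hX : (tensorLeft X).IsLeftAdjoint) {f g : X ⊗ W ⟶ N}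
    (h : ∀ (x : 𝟙_ C ⟶ X) (w : 𝟙_ C ⟶ W), pureTensor x w ≫ f = pureTensor x w ≫ g) : f = g := by
  have adj := Adjunction.ofIsLeftAdjoint (tensorLeft X)
  apply (adj.homEquiv W N).injective
  apply hom_ext_elements hZ
  intro w
  have key : ∀ k : X ⊗ W ⟶ N, w ≫ adj.homEquiv W N k = adj.homEquiv _ N (X ◁ w ≫ k) :=
    fun k => (adj.homEquiv_naturality_left w k).symm
  rw [key, key]
  congr 1
  rw [← cancel_epi (ρ_ X).inv]
  apply hom_ext_elements hZ
  intro x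
  simpa using h x w

end Separation

/-! ### Central morphisms into an Azumaya monoid -/

section Center

variable {C : Type u} [Category.{v} C] [MonoidalCategory C]

@[simp]
theorem pureTensor_scalar {Y : C} (k : 𝟙_ C ⟶ 𝟙_ C) (t : 𝟙_ C ⟶ Y) :
    pureTensor t k ≫ (ρ_ Y).hom = k ≫ t := by
  rw [pureTensor, MonoidalCategory.tensorHom_def', Category.assoc, Category.assoc,
    rightUnitor_naturality, ← leftUnitor_inv_naturality_assoc, unitors_inv_equal,
    Iso.inv_hom_id_assoc]

theorem comp_rightUnitor_inv {Y : C} (t : 𝟙_ C ⟶ Y) : t ≫ (ρ_ Y).inv = pureTensor t (𝟙 _) := by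
  rw [← comp_rightUnitor_inv_whiskerLeft, whiskerLeft_id, Category.comp_id]

theorem unit_comp_leftMul {A : Mon C} (t : 𝟙_ C ⟶ A.X) :
    η[A.X] ≫ leftMul t = η[A.X] ≫ rightMul t := by simp

theorem hom_ext_pureTensor₃ [Preadditive C] (hZ : (preadditiveCoyonedaObj (𝟙_ C)).Faithful)
    {X Y W N : C} (hX : (tensorLeft X).IsLeftAdjoint) (hY : (tensorLeft Y).IsLeftAdjoint)
    {f g : X ⊗ (Y ⊗ W) ⟶ N}
    (h : ∀ (x : 𝟙_ C ⟶ X) (y : 𝟙_ C ⟶ Y) (w : 𝟙_ C ⟶ W),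
      pureTensor x (pureTensor y w) ≫ f = pureTensor x (pureTensor y w) ≫ g) : f = g := by
  have hXY : (tensorLeft (X ⊗ Y)).IsLeftAdjoint :=
    Functor.isLeftAdjoint_of_iso (tensorLeftTensor X Y).symm
  rw [← cancel_epi (α_ X Y W).hom]
  refine hom_ext_pureTensor hZ hXY fun p w => ?_
  -- The element `p` of `X ⊗ Y` need not be a pure tensor, so `w` is fixed and morphisms out of `X ⊗
  -- Y` are compared instead.
  suffices (ρ_ (X ⊗ Y)).inv ≫ (X ⊗ Y) ◁ w ≫ (α_ X Y W).hom ≫ f =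
      (ρ_ (X ⊗ Y)).inv ≫ (X ⊗ Y) ◁ w ≫ (α_ X Y W).hom ≫ g by
    rw [← comp_rightUnitor_inv_whiskerLeft_assoc, this, comp_rightUnitor_inv_whiskerLeft_assoc]
  refine hom_ext_pureTensor hZ hX fun x y => ?_
  rw [comp_rightUnitor_inv_whiskerLeft_assoc, comp_rightUnitor_inv_whiskerLeft_assoc,
    pureTensor_associator_hom_assoc, pureTensor_associator_hom_assoc]
  exact h x y w

variable [SymmetricCategory C] [Preadditive C]

/-- A morphism into an Azumaya monoid that commutes with all global elements factors through the
unit. -/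
theorem exists_factor_unit (hZ : (preadditiveCoyonedaObj (𝟙_ C)).Faithful) (A : Mon C)
    [hA : IsAzumaya A] (hHom : (tensorLeft A.X).IsLeftAdjoint) {W : C} (f : W ⟶ A.X)
    (hf : ∀ t : 𝟙_ C ⟶ A.X, f ≫ leftMul t = f ≫ rightMul t) : ∃ k : W ⟶ 𝟙_ C, k ≫ η[A.X] = f := by
  have := hA.isEquivalence
  -- The map `a ⊗ w ↦ a f(w)` is always left linear; it is right linear because `f` commutes with
  -- global elements. Fullness gives `F = A ⊗ k`, and evaluating at `a = 1` gives `f = u ∘ k`.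
  let F : (tensorBimod A).obj W ⟶ (tensorBimod A).obj (𝟙_ C) :=
    { hom := (A.X ◁ f ≫ μ[A.X]) ≫ (ρ_ A.X).inv
      left_act_hom := by
        change ((α_ A.X A.X W).inv ≫ μ[A.X] ▷ W) ≫ (A.X ◁ f ≫ μ[A.X]) ≫ (ρ_ A.X).inv =
          A.X ◁ ((A.X ◁ f ≫ μ[A.X]) ≫ (ρ_ A.X).inv) ≫ (α_ A.X A.X (𝟙_ C)).inv ≫ μ[A.X] ▷ 𝟙_ C
        refine hom_ext_pureTensor₃ hZ hHom hHom fun a b w => ?_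
        simp only [Category.assoc, pureTensor_associator_inv_assoc, pureTensor_whiskerRight_assoc,
          pureTensor_whiskerRight, pureTensor_whiskerLeft_assoc, pureTensor_mul,
          pureTensor_mul_assoc, comp_rightUnitor_inv, mulZ_assoc]
      right_act_hom := by
        change ((α_ A.X W A.X).hom ≫ A.X ◁ (β_ W A.X).hom ≫ (α_ A.X A.X W).inv ≫ μ[A.X] ▷ W) ≫
            (A.X ◁ f ≫ μ[A.X]) ≫ (ρ_ A.X).inv =
          ((A.X ◁ f ≫ μ[A.X]) ≫ (ρ_ A.X).inv) ▷ A.X ≫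
            (α_ A.X (𝟙_ C) A.X).hom ≫ A.X ◁ (β_ (𝟙_ C) A.X).hom ≫ (α_ A.X A.X (𝟙_ C)).inv ≫
              μ[A.X] ▷ 𝟙_ C
        -- No adjoint is available for `W ⊗ -`, so the braiding moves `W` to the last place before
        -- testing on pure tensors.
        rw [← cancel_epi (α_ A.X W A.X).inv, ← cancel_epi (A.X ◁ (β_ A.X W).hom)]
        refine hom_ext_pureTensor₃ hZ hHom hHom fun a b w => ?_
        have h : mulZ b (w ≫ f) = mulZ (w ≫ f) b := by
          simpa only [← Category.assoc, comp_leftMul, comp_rightMul] using w ≫= hf b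
        simp only [Category.assoc, pureTensor_associator_inv_assoc, pureTensor_whiskerRight_assoc,
          pureTensor_whiskerRight, pureTensor_whiskerLeft_assoc, pureTensor_mul,
          pureTensor_mul_assoc, comp_rightUnitor_inv, mulZ_assoc, pureTensor_braiding,
          pureTensor_associator_hom_assoc, h] }
  obtain ⟨k, hk⟩ := (tensorBimod A).map_surjective F
  have hk' : A.X ◁ k = (A.X ◁ f ≫ μ[A.X]) ≫ (ρ_ A.X).inv := congrArg Bimod.Hom.hom hk
  refine ⟨k, hom_ext_elements hZ fun w => ?_⟩
  have h := congrArg (fun φ => pureTensor η[A.X] w ≫ φ ≫ (ρ_ A.X).hom) hk'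
  simpa using h

end Center

/-! ### The Morita context of the subobjects `J` -/

section MoritaContext

variable {C : Type u} [Category.{v} C] [MonoidalCategory C] [Abelian C] [WellPowered.{v} C]
  [HasLimits C]

theorem factors_J_iff {A : Mon C} {σ δ : ZObj A → ZObj A} {W : C} (f : W ⟶ A.X) :
    (J.{v, u} A σ δ).Factors f ↔
      ∀ t : 𝟙_ C ⟶ A.X, f ≫ leftMul (σ t) = f ≫ rightMul (δ t) :=
  J_factors_iff f

theorem J_comm (A : Mon C) (σ δ : ZObj A → ZObj A) (t : 𝟙_ C ⟶ A.X) :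
    (J.{v, u} A σ δ).arrow ≫ leftMul (σ t) = (J.{v, u} A σ δ).arrow ≫ rightMul (δ t) :=
  J_condition A σ δ t

variable [SymmetricCategory C]

/-- For surjective `δ`, the subobject `J δ δ` of an Azumaya monoid is the unit subobject. -/
theorem exists_iso_J_diag (hZ : (preadditiveCoyonedaObj (𝟙_ C)).Faithful) (A : Mon C)
    [IsAzumaya A] (hHom : (tensorLeft A.X).IsLeftAdjoint) {δ : ZObj A → ZObj A}
    (hδ : Function.Surjective δ) :
    ∃ e : (J.{v, u} A δ δ : C) ≅ 𝟙_ C, e.hom ≫ η[A.X] = (J.{v, u} A δ δ).arrow := by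
  obtain ⟨k, hk⟩ := exists_factor_unit hZ A hHom (J.{v, u} A δ δ).arrow fun t => by
    obtain ⟨s, rfl⟩ := hδ t
    exact J_comm A δ δ s
  have hη : (J.{v, u} A δ δ).Factors η[A.X] := (factors_J_iff _).2 fun t => unit_comp_leftMul (δ t)
  refine ⟨⟨k, (J.{v, u} A δ δ).factorThru _ hη, ?_, ?_⟩, hk⟩
  · rw [← cancel_mono (J.{v, u} A δ δ).arrow]
    simp [hk]
  · rw [← cancel_mono η[A.X]]
    simp [hk]

variable [HasColimits C]

/-- Under `J δ δ ≅ 𝟙` both actions become unit constraints, so the two arrows defining the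
coequalizer agree by the triangle identity and the projection is an isomorphism. -/
theorem isIso_jMulBar_iff (hZ : (preadditiveCoyonedaObj (𝟙_ C)).Faithful) (A : Mon C)
    [IsAzumaya A] (hHom : (tensorLeft A.X).IsLeftAdjoint) (σ τ : ZObj A → ZObj A)
    {δ : ZObj A → ZObj A} (hδ : Function.Surjective δ) :
    IsIso (jMulBar A σ δ τ) ↔ IsIso (jMul A σ δ τ) := by
  obtain ⟨e, he⟩ := exists_iso_J_diag hZ A hHom hδ
  have he' : e.inv ≫ (J.{v, u} A δ δ).arrow = η[A.X] := by rw [← he, Iso.inv_hom_id_assoc]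
  have h1 : (J.{v, u} A σ δ : C) ◁ e.inv ≫ jMul A σ δ δ = (ρ_ _).hom := by
    rw [← cancel_mono (J.{v, u} A σ δ).arrow, Category.assoc, jMul_arrow,
      ← id_tensorHom, tensorHom_comp_tensorHom_assoc, he', Category.id_comp,
      MonoidalCategory.tensorHom_def, Category.assoc, MonObj.mul_one, rightUnitor_naturality]
  have h2 : e.inv ▷ (J.{v, u} A δ τ : C) ≫ jMul A δ δ τ = (λ_ _).hom := by
    rw [← cancel_mono (J.{v, u} A δ τ).arrow, Category.assoc, jMul_arrow,
      ← tensorHom_id, tensorHom_comp_tensorHom_assoc, he', Category.id_comp,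
      MonoidalCategory.tensorHom_def', Category.assoc, MonObj.one_mul, leftUnitor_naturality]
  have h : jMul A σ δ δ ▷ (J.{v, u} A δ τ : C) =
      (α_ _ _ _).hom ≫ (J.{v, u} A σ δ : C) ◁ jMul A δ δ τ := by
    rw [← cancel_epi (((J.{v, u} A σ δ : C) ◁ e.inv) ▷ (J.{v, u} A δ τ : C)),
      ← comp_whiskerRight, h1, associator_naturality_middle_assoc, ← whiskerLeft_comp, h2,
      triangle]
  have hπ := coequalizer.π_of_eq h
  have hc : coequalizer.π _ _ ≫ jMulBar A σ δ τ = jMul A σ δ τ := coequalizer.π_desc _ _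
  rw [← hc]
  constructor
  · intro h'
    exact IsIso.comp_isIso' hπ h'
  · intro h'
    exact @IsIso.of_isIso_comp_left _ _ _ _ _ _ _ hπ h'

end MoritaContext

/-! ### The inner action of an invertible subobject -/

section Conj

variable {C : Type u} [Category.{v} C] [MonoidalCategory C] {A : Mon C} {X Y : C} {i : X ⟶ A.X}
  {j : Y ⟶ A.X}

namespace InverseDatum

theorem isLeftAdjoint (d : InverseDatum A i j) : (tensorLeft X).IsLeftAdjoint :=
  have := d.tensorLeft_isEquivalence
  inferInstance

/-- `t ↦ ∑ x t y`, where `∑ x ⊗ y` is the preimage of `1` in `X ⊗ Y`. -/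
def conj (d : InverseDatum A i j) (t : 𝟙_ C ⟶ A.X) : 𝟙_ C ⟶ A.X :=
  d.mX.inv ≫ (i ⊗ₘ (j ≫ leftMul t)) ≫ μ[A.X]

theorem miyashita_eq_conj (d : InverseDatum A i j) (t : 𝟙_ C ⟶ A.X) :
    miyashita d t = d.conj t := by
  have : triLeft (Bimod.regular A) t j = j ≫ leftMul t := by
    rw [leftMul_eq]
    change (λ_ Y).inv ≫ (t ⊗ₘ j) ≫ μ[A.X] = _
    rw [MonoidalCategory.tensorHom_def', Category.assoc, leftUnitor_inv_naturality_assoc]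
  rw [conj, ← this]
  rfl

theorem inv_mul (d : InverseDatum A i j) : d.mX.inv ≫ (i ⊗ₘ j) ≫ μ[A.X] = η[A.X] := by
  rw [← d.mX_unit, Iso.inv_hom_id_assoc]

theorem inv_mul_assoc (d : InverseDatum A i j) {Z : C} (h : A.X ⟶ Z) :
    d.mX.inv ≫ (i ⊗ₘ j) ≫ μ[A.X] ≫ h = η[A.X] ≫ h := by
  rw [← d.inv_mul]; simp only [Category.assoc]

/-- The product `x y` lies in the image of `Z(𝟙)`, and scalars are central in `Z(A)`. -/
theorem mulZ_central (d : InverseDatum A i j) (x : 𝟙_ C ⟶ X) (y : 𝟙_ C ⟶ Y) (t : 𝟙_ C ⟶ A.X) :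
    mulZ (x ≫ i) (mulZ (y ≫ j) t) = mulZ t (mulZ (x ≫ i) (y ≫ j)) := by
  have : mulZ (x ≫ i) (y ≫ j) = (pureTensor x y ≫ d.mX.hom) ≫ η[A.X] := by
    rw [Category.assoc, d.mX_unit, pureTensor_tensorHom_assoc, pureTensor_mul]
  rw [← mulZ_assoc, this, scalar_mulZ, mulZ_scalar]

variable [Preadditive C]

/-- Since `y' x` is a scalar, `∑ x' t y' x = ∑ x' y' x t = x t`. -/
theorem conj_mulZ_arrow (hZ : (preadditiveCoyonedaObj (𝟙_ C)).Faithful) (d : InverseDatum A i j)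
    (t : 𝟙_ C ⟶ A.X) (x : 𝟙_ C ⟶ X) : mulZ (d.conj t) (x ≫ i) = mulZ (x ≫ i) t := by
  have h : (i ⊗ₘ (j ≫ leftMul t)) ≫ μ[A.X] ≫ rightMul (x ≫ i) =
      (i ⊗ₘ j) ≫ μ[A.X] ≫ rightMul (mulZ (x ≫ i) t) := by
    refine hom_ext_pureTensor hZ d.isLeftAdjoint fun x' y' => ?_
    have := d.symm.mulZ_central y' x t
    simp [← Category.assoc, this]
  rw [← comp_rightMul, conj, Category.assoc, Category.assoc, h, d.inv_mul_assoc, comp_rightMul,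
    one_mulZ]

/-- Since `y x'` is a scalar, `∑ y x' t y' = ∑ t y x' y' = t y`. -/
theorem arrow_mulZ_conj (hZ : (preadditiveCoyonedaObj (𝟙_ C)).Faithful) (d : InverseDatum A i j)
    (t : 𝟙_ C ⟶ A.X) (y : 𝟙_ C ⟶ Y) : mulZ (y ≫ j) (d.conj t) = mulZ t (y ≫ j) := by
  have h : (i ⊗ₘ (j ≫ leftMul t)) ≫ μ[A.X] ≫ leftMul (y ≫ j) =
      (i ⊗ₘ j) ≫ μ[A.X] ≫ leftMul (mulZ t (y ≫ j)) := by
    refine hom_ext_pureTensor hZ d.isLeftAdjoint fun x' y' => ?_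
    have := congrArg (fun r => mulZ r (y' ≫ j)) (d.symm.mulZ_central y x' t)
    simp only [mulZ_assoc] at this
    simp [← Category.assoc, this]
  rw [← comp_leftMul, conj, Category.assoc, Category.assoc, h, d.inv_mul_assoc, comp_leftMul,
    mulZ_one]

/-- Here `∑ x t y = ∑ s x y = s`. Together with `conj_mulZ_arrow` this characterises the action by
commutation with `X` alone, and its formal properties follow by checking that relation. -/
theorem conj_eq (hZ : (preadditiveCoyonedaObj (𝟙_ C)).Faithful) (d : InverseDatum A i j)
    {s t : 𝟙_ C ⟶ A.X} (h : ∀ x : 𝟙_ C ⟶ X, mulZ s (x ≫ i) = mulZ (x ≫ i) t) : d.conj t = s := by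
  have h' : (i ⊗ₘ (j ≫ leftMul t)) ≫ μ[A.X] = (i ⊗ₘ j) ≫ μ[A.X] ≫ leftMul s := by
    refine hom_ext_pureTensor hZ d.isLeftAdjoint fun x y => ?_
    rw [pureTensor_tensorHom_assoc, pureTensor_tensorHom_assoc, pureTensor_mul,
      pureTensor_mul_assoc, comp_leftMul, ← Category.assoc, comp_leftMul, ← mulZ_assoc,
      ← mulZ_assoc, h]
  rw [conj, h', d.inv_mul_assoc, comp_leftMul, mulZ_one]

theorem conj_one (hZ : (preadditiveCoyonedaObj (𝟙_ C)).Faithful) (d : InverseDatum A i j) :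
    d.conj η[A.X] = η[A.X] :=
  d.conj_eq hZ fun x => by simp

theorem conj_mulZ (hZ : (preadditiveCoyonedaObj (𝟙_ C)).Faithful) (d : InverseDatum A i j)
    (s t : 𝟙_ C ⟶ A.X) : d.conj (mulZ s t) = mulZ (d.conj s) (d.conj t) :=
  d.conj_eq hZ fun x => by
    rw [mulZ_assoc, d.conj_mulZ_arrow hZ, ← mulZ_assoc, d.conj_mulZ_arrow hZ, mulZ_assoc]

theorem symm_conj_conj (hZ : (preadditiveCoyonedaObj (𝟙_ C)).Faithful) (d : InverseDatum A i j)
    (t : 𝟙_ C ⟶ A.X) : d.symm.conj (d.conj t) = t :=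
  d.symm.conj_eq hZ fun y => (d.arrow_mulZ_conj hZ t y).symm

theorem conj_congr (hZ : (preadditiveCoyonedaObj (𝟙_ C)).Faithful) (d : InverseDatum A i j)
    {X' Y' : C} {i' : X' ⟶ A.X} {j' : Y' ⟶ A.X} (d' : InverseDatum A i' j') [Mono i] [Mono i']
    (h : Subobject.mk i = Subobject.mk i') (t : 𝟙_ C ⟶ A.X) : d.conj t = d'.conj t := by
  refine d.conj_eq hZ fun x => ?_
  have : x ≫ i = (x ≫ (Subobject.isoOfMkEqMk _ _ h).hom) ≫ i' := by simp
  rw [this, d'.conj_mulZ_arrow hZ]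

theorem conj_tensor (hZ : (preadditiveCoyonedaObj (𝟙_ C)).Faithful) (d : InverseDatum A i j)
    {X' Y' : C} {i' : X' ⟶ A.X} {j' : Y' ⟶ A.X} (d' : InverseDatum A i' j') (t : 𝟙_ C ⟶ A.X) :
    (d.tensor d').conj t = d.conj (d'.conj t) := by
  refine (d.tensor d').conj_eq hZ fun w => ?_
  -- An element `w` of `X ⊗ X'` need not be pure, so the commutation relation is first proved for
  -- the whole morphism out of `X ⊗ X'`.
  have h : ((i ⊗ₘ i') ≫ μ[A.X]) ≫ leftMul (d.conj (d'.conj t)) =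
      ((i ⊗ₘ i') ≫ μ[A.X]) ≫ rightMul t := by
    refine hom_ext_pureTensor hZ d.isLeftAdjoint fun x x' => ?_
    simp only [Category.assoc, pureTensor_tensorHom_assoc, pureTensor_mul_assoc, comp_leftMul,
      comp_rightMul]
    rw [← mulZ_assoc, d.conj_mulZ_arrow hZ, mulZ_assoc, d'.conj_mulZ_arrow hZ, mulZ_assoc]
  rw [← comp_leftMul, ← comp_rightMul, Category.assoc w, Category.assoc w, h]

variable [SymmetricCategory C]

/-- On pure tensors both sides send `x ⊗ y` to `x t y`. Through this, every property of `Γ_X`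
reduces to one of `Φ_X`. -/
theorem comp_gamma (hZ : (preadditiveCoyonedaObj (𝟙_ C)).Faithful) (d : InverseDatum A i j)
    (t : 𝟙_ C ⟶ A.X) : t ≫ gamma d = d.conj t := by
  have h : (λ_ (X ⊗ Y)).inv ≫ t ▷ (X ⊗ Y) ≫ (α_ A.X X Y).inv ≫ (β_ A.X X).hom ▷ Y ≫
      (α_ X A.X Y).hom ≫ (i ⊗ₘ (𝟙 A.X ⊗ₘ j)) ≫ A.X ◁ μ[A.X] ≫ μ[A.X] =
      (i ⊗ₘ (j ≫ leftMul t)) ≫ μ[A.X] := by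
    refine hom_ext_pureTensor hZ d.isLeftAdjoint fun x y => ?_
    rw [comp_leftUnitor_inv_whiskerRight_assoc]
    simp [← Category.assoc]
  have h' : t ≫ (ρ_ A.X).inv ≫ A.X ◁ d.mX.inv = d.mX.inv ≫ (λ_ (X ⊗ Y)).inv ≫ t ▷ (X ⊗ Y) := by
    rw [comp_rightUnitor_inv_whiskerLeft, comp_leftUnitor_inv_whiskerRight]
  rw [conj, ← h, gamma, ← Category.assoc (ρ_ A.X).inv, ← Category.assoc t, h']
  simp only [Category.assoc]

theorem gamma_comp_symm_gamma (hZ : (preadditiveCoyonedaObj (𝟙_ C)).Faithful)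
    (d : InverseDatum A i j) : gamma d ≫ gamma d.symm = 𝟙 A.X :=
  hom_ext_elements hZ fun t => by
    rw [← Category.assoc, comp_gamma hZ, comp_gamma hZ, d.symm_conj_conj hZ, Category.comp_id]

/-- `Γ_X` as a morphism of monoids. -/
def gammaHom (hZ : (preadditiveCoyonedaObj (𝟙_ C)).Faithful)
    (hHom : (tensorLeft A.X).IsLeftAdjoint) (d : InverseDatum A i j) : A ⟶ A :=
  .mk' (gamma d) (by rw [d.comp_gamma hZ, d.conj_one hZ]) (by
    refine hom_ext_pureTensor hZ hHom fun s t => ?_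
    rw [pureTensor_tensorHom_assoc, pureTensor_mul_assoc, pureTensor_mul]
    simp only [d.comp_gamma hZ, d.conj_mulZ hZ])

/-- `Γ_X` as an automorphism of monoids. -/
def gammaAut (hZ : (preadditiveCoyonedaObj (𝟙_ C)).Faithful)
    (hHom : (tensorLeft A.X).IsLeftAdjoint) (d : InverseDatum A i j) : Aut A where
  hom := d.gammaHom hZ hHom
  inv := d.symm.gammaHom hZ hHom
  hom_inv_id := by
    ext
    exact d.gamma_comp_symm_gamma hZ
  inv_hom_id := by
    ext
    exact d.symm.gamma_comp_symm_gamma hZ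

end InverseDatum

end Conj

/-! ### Invertible subobjects are the `J θ 1` -/

section InvertibleJ

variable {C : Type u} [Category.{v} C] [MonoidalCategory C] [Abelian C] [WellPowered.{v} C]
  [HasLimits C] {A : Mon C} {X Y : C} {i : X ⟶ A.X} {j : Y ⟶ A.X}

theorem InverseDatum.conj_eq_of_J (hZ : (preadditiveCoyonedaObj (𝟙_ C)).Faithful)
    {θ : ZObj A → ZObj A} (d : InverseDatum A (J.{v, u} A θ id).arrow j) (t : 𝟙_ C ⟶ A.X) :
    d.conj t = θ t := by
  refine d.conj_eq hZ fun x => ?_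
  have h := x ≫= J_comm A θ id t
  rw [← Category.assoc, ← Category.assoc] at h
  exact (comp_leftMul _ _).symm.trans (h.trans (comp_rightMul _ _))

variable [SymmetricCategory C]

/-- The relation `Φ_X(t) x = x t` puts `X` inside `J`. Conversely, for `z` in `J` and `y` in `Y` one
has `y z t = y Φ_X(t) z = t y z`, so `y z` is a scalar and `z = ∑ x (y z)` lies in `X`. -/
theorem InverseDatum.mk_eq_J (hZ : (preadditiveCoyonedaObj (𝟙_ C)).Faithful) [IsAzumaya A]
    (hHom : (tensorLeft A.X).IsLeftAdjoint) [Mono i] (d : InverseDatum A i j)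
    {θ : ZObj A → ZObj A} (hθ : ∀ t : 𝟙_ C ⟶ A.X, θ t = d.conj t) :
    Subobject.mk i = J.{v, u} A θ id := by
  have hJ (t : 𝟙_ C ⟶ A.X) (z : 𝟙_ C ⟶ (J.{v, u} A θ id : C)) :
      mulZ (d.conj t) (z ≫ (J.{v, u} A θ id).arrow) =
        mulZ (z ≫ (J.{v, u} A θ id).arrow) t := by
    have h := z ≫= J_comm A θ id t
    rw [hθ t, ← Category.assoc, ← Category.assoc, comp_leftMul] at h
    exact h.trans (comp_rightMul _ _)
  have hX : (J.{v, u} A θ id).Factors i := (factors_J_iff _).2 fun t => by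
    rw [hθ t]
    refine hom_ext_elements hZ fun x => ?_
    rw [← Category.assoc, ← Category.assoc, comp_leftMul, d.conj_mulZ_arrow hZ]
    exact (comp_rightMul _ _).symm
  obtain ⟨k, hk⟩ := exists_factor_unit hZ A hHom ((j ⊗ₘ (J.{v, u} A θ id).arrow) ≫ μ[A.X])
    fun t => by
      refine hom_ext_pureTensor hZ d.symm.isLeftAdjoint fun y z => ?_
      simp only [pureTensor_tensorHom_assoc, pureTensor_mul_assoc, comp_leftMul, comp_rightMul,
        Category.assoc]
      rw [← mulZ_assoc, ← d.arrow_mulZ_conj hZ, mulZ_assoc, mulZ_assoc, hJ]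
  -- The second inclusion is realised by `z ↦ ∑ x ⊗ y ⊗ z ↦ ∑ x k(y ⊗ z)`.
  refine le_antisymm (Subobject.mk_le_of_comm ((J.{v, u} A θ id).factorThru i hX) (by simp))
    (Subobject.le_mk_of_comm ((λ_ _).inv ≫ d.mX.inv ▷ _ ≫ (α_ X Y _).hom ≫ X ◁ k ≫ (ρ_ X).hom) ?_)
  refine hom_ext_elements hZ fun z => ?_
  have h : (ρ_ (X ⊗ Y)).inv ≫ (X ⊗ Y) ◁ z ≫ (α_ X Y _).hom ≫ X ◁ k ≫ (ρ_ X).hom ≫ i =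
      (i ⊗ₘ j) ≫ μ[A.X] ≫ rightMul (z ≫ (J.{v, u} A θ id).arrow) := by
    refine hom_ext_pureTensor hZ d.isLeftAdjoint fun x y => ?_
    rw [comp_rightUnitor_inv_whiskerLeft_assoc, pureTensor_associator_hom_assoc,
      pureTensor_whiskerLeft_assoc, ← Category.assoc, pureTensor_scalar, Category.assoc,
      ← mulZ_scalar, Category.assoc, hk]
    simp
  have h' : z ≫ (λ_ _).inv ≫ d.mX.inv ▷ (J.{v, u} A θ id : C) =
      d.mX.inv ≫ (ρ_ (X ⊗ Y)).inv ≫ (X ⊗ Y) ◁ z := by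
    rw [comp_rightUnitor_inv_whiskerLeft, comp_leftUnitor_inv_whiskerRight]
  calc _ = (z ≫ (λ_ _).inv ≫ d.mX.inv ▷ (J.{v, u} A θ id : C)) ≫
        (α_ X Y _).hom ≫ X ◁ k ≫ (ρ_ X).hom ≫ i := by simp only [Category.assoc]
    _ = d.mX.inv ≫ (i ⊗ₘ j) ≫ μ[A.X] ≫ rightMul (z ≫ (J.{v, u} A θ id).arrow) := by
        rw [h', ← h]; simp only [Category.assoc]
    _ = _ := by rw [d.inv_mul_assoc, comp_rightMul, one_mulZ]

/-- If the multiplications between `J θ 1` and `J 1 θ` are isomorphisms, these subobjects are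
inverse to each other. -/
theorem nonempty_inverseDatum_J (hZ : (preadditiveCoyonedaObj (𝟙_ C)).Faithful) [IsAzumaya A]
    (hHom : (tensorLeft A.X).IsLeftAdjoint) {θ : ZObj A → ZObj A} (hθ : Function.Surjective θ)
    (h₁ : IsIso (jMul A θ id θ)) (h₂ : IsIso (jMul A id θ id)) :
    Nonempty (InverseDatum A (J.{v, u} A θ id).arrow (J.{v, u} A id θ).arrow) := by
  obtain ⟨e₁, he₁⟩ := exists_iso_J_diag hZ A hHom hθ
  obtain ⟨e₂, he₂⟩ := exists_iso_J_diag hZ A hHom Function.surjective_id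
  exact ⟨⟨asIso (jMul A θ id θ) ≪≫ e₁, asIso (jMul A id θ id) ≪≫ e₂, by
    simp [he₁, jMul_arrow], by simp [he₂, jMul_arrow]⟩⟩

end InvertibleJ

/-! ### Divisibility of twisted bimodules in terms of global elements -/

section TwistedElements

variable {C : Type u} [Category.{v} C] [MonoidalCategory C] {A : Mon C}

/-- A left linear endomorphism is determined by its value at the unit: `f(a) = a f(1)`. -/
theorem eq_rightMul {f : A.X ⟶ A.X} (hf : μ[A.X] ≫ f = A.X ◁ f ≫ μ[A.X]) :
    f = rightMul (η[A.X] ≫ f) := by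
  rw [rightMul_eq, whiskerLeft_comp, Category.assoc, ← hf, MonObj.mul_one_assoc,
    Iso.inv_hom_id_assoc]

theorem triRight_regular (f : A.X ⟶ A.X) (t : 𝟙_ C ⟶ A.X) :
    triRight (A := A) (Bimod.regular A) f t = f ≫ rightMul t := by
  rw [rightMul_eq]
  change (ρ_ A.X).inv ≫ (f ⊗ₘ t) ≫ μ[A.X] = _
  rw [MonoidalCategory.tensorHom_def, Category.assoc, rightUnitor_inv_naturality_assoc]

theorem rightMul_comm {s t a : 𝟙_ C ⟶ A.X} (h : mulZ s a = mulZ a t) :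
    (𝟙 A.X ≫ rightMul s) ≫ rightMul a = rightMul a ≫ rightMul t := by
  rw [Category.id_comp, rightMul_comp_rightMul, rightMul_comp_rightMul, h]

theorem mulZ_comm_of_leftLinear {f : A.X ⟶ A.X} (hf : μ[A.X] ≫ f = A.X ◁ f ≫ μ[A.X])
    {s t : 𝟙_ C ⟶ A.X} (h : (𝟙 A.X ≫ rightMul s) ≫ f = f ≫ rightMul t) :
    mulZ s (η[A.X] ≫ f) = mulZ (η[A.X] ≫ f) t := by
  rw [← comp_rightMul, ← comp_rightMul, ← eq_rightMul hf, Category.assoc, ← h]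
  simp

theorem isTwistedHom_rightMul {σ τ : ZObj A → ZObj A} {a : 𝟙_ C ⟶ A.X}
    (ha : ∀ z : 𝟙_ C ⟶ A.X, mulZ (σ z) a = mulZ (A := A) a (τ z)) :
    IsTwistedHom (Bimod.regular A) σ (Bimod.regular A) τ (rightMul a) :=
  ⟨mul_rightMul a, fun z =>
    (congrArg (· ≫ rightMul a) (triRight_regular (𝟙 A.X) (σ z))).trans
      ((rightMul_comm (ha z)).trans (triRight_regular (rightMul a) (τ z)).symm)⟩

theorem IsTwistedHom.unit_comp {σ τ : ZObj A → ZObj A} {f : A.X ⟶ A.X}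
    (hf : IsTwistedHom (Bimod.regular A) σ (Bimod.regular A) τ f) (z : 𝟙_ C ⟶ A.X) :
    mulZ (σ z) (η[A.X] ≫ f) = mulZ (A := A) (η[A.X] ≫ f) (τ z) :=
  mulZ_comm_of_leftLinear hf.1 ((congrArg (· ≫ f) (triRight_regular (𝟙 A.X) (σ z))).symm.trans
    ((hf.2 z).trans (triRight_regular f (τ z))))

theorem rightMul_sum [Preadditive C] [MonoidalPreadditive C] {k : ℕ} (a : Fin k → (𝟙_ C ⟶ A.X)) :
    rightMul (∑ l, a l) = ∑ l, rightMul (a l) := by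
  simp only [rightMul_eq, whiskerLeft_sum, Preadditive.sum_comp, Preadditive.comp_sum]

theorem sum_rightMul_eq_id_iff [Preadditive C] [MonoidalPreadditive C] {k : ℕ}
    (a b : Fin k → (𝟙_ C ⟶ A.X)) :
    ∑ l, rightMul (a l) ≫ rightMul (b l) = 𝟙 A.X ↔ ∑ l, mulZ (a l) (b l) = η[A.X] := by
  simp only [rightMul_comp_rightMul, ← rightMul_sum]
  constructor
  · intro h
    rw [← one_mulZ (∑ l, mulZ (a l) (b l)), ← comp_rightMul, h, Category.comp_id]
  · intro h
    rw [h, rightMul_one]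

/-- Twisted morphisms are right multiplications by elements intertwining `σ` and `τ`, and
composition of right multiplications is the product in `Z(A)`. -/
theorem twistedDivides_iff [Preadditive C] [MonoidalPreadditive C] {σ τ : ZObj A → ZObj A} :
    TwistedDivides (Bimod.regular A) σ (Bimod.regular A) τ ↔
      ∃ k : ℕ, 1 ≤ k ∧ ∃ a b : Fin k → (𝟙_ C ⟶ A.X),
        (∀ l (z : 𝟙_ C ⟶ A.X), mulZ (σ z) (a l) = mulZ (A := A) (a l) (τ z)) ∧
        (∀ l (z : 𝟙_ C ⟶ A.X), mulZ (τ z) (b l) = mulZ (A := A) (b l) (σ z)) ∧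
        ∑ l, mulZ (a l) (b l) = η[A.X] := by
  constructor
  · rintro ⟨k, hk, f, g, hf, hg, h⟩
    refine ⟨k, hk, fun l => η[A.X] ≫ f l, fun l => η[A.X] ≫ g l, fun l z => (hf l).unit_comp z,
      fun l z => (hg l).unit_comp z, ?_⟩
    refine (sum_rightMul_eq_id_iff _ _).1 (Eq.trans (Finset.sum_congr rfl fun l _ => ?_) h)
    rw [← eq_rightMul (hf l).1, ← eq_rightMul (hg l).1]
    rfl
  · rintro ⟨k, hk, a, b, ha, hb, h⟩
    refine ⟨k, hk, fun l => rightMul (a l), fun l => rightMul (b l),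
      fun l => isTwistedHom_rightMul (ha l), fun l => isTwistedHom_rightMul (hb l),
      (sum_rightMul_eq_id_iff a b).2 h⟩

end TwistedElements

/-! ### The Morita context is strict when the bimodules are similar -/

section Strict

variable {C : Type u} [Category.{v} C] [MonoidalCategory C] {A : Mon C}

/-- Writing a multiple of `t` through `k ≫ η` makes the compatibility of a pairing with the
multiplication of `A` applicable. -/
theorem scalar_comp {W : C} (k : W ⟶ 𝟙_ C) (t : 𝟙_ C ⟶ A.X) :
    k ≫ t = k ≫ η[A.X] ≫ rightMul t := by simp

variable [Preadditive C] [MonoidalPreadditive C]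

/-- A dual basis argument: the inverse of `m` is the element `∑ a_l ⊗ b_l`. With `φ_l(y) = m'(y ⊗
a_l)`, associativity gives `m(x ⊗ y) a_l = x φ_l(y)`, and `∑ φ_l(y) b_l = ∑ y a_l b_l = y`. -/
theorem isIso_of_sum_mulZ [Mono η[A.X]] {I I' : C} {i : I ⟶ A.X} {i' : I' ⟶ A.X} [Mono i]
    [Mono i'] {m : I ⊗ I' ⟶ 𝟙_ C} {m' : I' ⊗ I ⟶ 𝟙_ C} (hm : m ≫ η[A.X] = (i ⊗ₘ i') ≫ μ[A.X])
    (hm' : m' ≫ η[A.X] = (i' ⊗ₘ i) ≫ μ[A.X]) {k : ℕ} (a : Fin k → (𝟙_ C ⟶ I))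
    (b : Fin k → (𝟙_ C ⟶ I')) (h : ∑ l, mulZ (a l ≫ i) (b l ≫ i') = η[A.X]) : IsIso m := by
  let φ : Fin k → (I' ⟶ 𝟙_ C) := fun l => (ρ_ I').inv ≫ I' ◁ a l ≫ m'
  have hφ (l) : φ l ≫ η[A.X] = i' ≫ rightMul (a l ≫ i) := by
    simp only [φ, Category.assoc, hm', rightMul_eq, MonoidalCategory.tensorHom_def',
      whiskerLeft_comp]
    rw [whisker_exchange_assoc, whisker_exchange_assoc, ← rightUnitor_inv_naturality_assoc]
  have h₁ (l) : m ≫ a l = I ◁ φ l ≫ (ρ_ I).hom := by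
    have : (i ⊗ₘ i') ≫ A.X ◁ rightMul (a l ≫ i) = i ⊗ₘ (φ l ≫ η[A.X]) := by
      rw [hφ, tensor_comp_right]
    rw [← cancel_mono i, Category.assoc, scalar_comp m, reassoc_of% hm, mul_rightMul,
      reassoc_of% this, MonoidalCategory.tensorHom_def', whiskerLeft_comp, Category.assoc,
      Category.assoc, whisker_exchange_assoc, MonObj.mul_one, rightUnitor_naturality,
      Category.assoc]
  have h₂ : ∑ l, φ l ≫ b l = 𝟙 I' := by
    have h₃ (l) : (φ l ≫ b l) ≫ i' = i' ≫ rightMul (mulZ (a l ≫ i) (b l ≫ i')) := by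
      rw [Category.assoc, scalar_comp, reassoc_of% hφ, rightMul_comp_rightMul]
    rw [← cancel_mono i', Preadditive.sum_comp, Finset.sum_congr rfl fun l _ => h₃ l,
      ← Preadditive.comp_sum, ← rightMul_sum, h, rightMul_one, Category.comp_id, Category.id_comp]
  refine ⟨∑ l, pureTensor (a l) (b l), ?_, ?_⟩
  · have h₃ (l) : m ≫ pureTensor (a l) (b l) = I ◁ (φ l ≫ b l) := by
      rw [← comp_rightUnitor_inv_whiskerLeft, reassoc_of% h₁, Iso.hom_inv_id_assoc]
      exact (whiskerLeft_comp I (φ l) (b l)).symm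
    rw [Preadditive.comp_sum, Finset.sum_congr rfl fun l _ => h₃ l, ← whiskerLeft_sum, h₂,
      whiskerLeft_id]
  · rw [← cancel_mono η[A.X], Preadditive.sum_comp, Preadditive.sum_comp, Category.id_comp]
    refine Eq.trans (Finset.sum_congr rfl fun l _ => ?_) h
    rw [Category.assoc, hm, pureTensor_tensorHom_assoc, pureTensor_mul]

end Strict

/-! ### Automorphisms of the monoid twist the regular bimodule trivially -/

section Automorphisms

variable {C : Type u} [Category.{v} C] [MonoidalCategory C] [Preadditive C] {A : Mon C}

/-- Left linearity gives `g(t) = t g(1)`. With its right-handed counterpart, `g(1)` is a Casimir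
element: `t g(1) = g(1) t` for the outer actions. -/
theorem comp_regular_outer_left (hZ : (preadditiveCoyonedaObj (𝟙_ C)).Faithful)
    (hHom : (tensorLeft A.X).IsLeftAdjoint) {g : A.X ⟶ A.X ⊗ A.X}
    (hg : μ[A.X] ≫ g = A.X ◁ g ≫ (α_ A.X A.X A.X).inv ≫ μ[A.X] ▷ A.X) (t : 𝟙_ C ⟶ A.X) :
    t ≫ g = (η[A.X] ≫ g) ≫ leftMul t ▷ A.X := by
  have h : (λ_ (A.X ⊗ A.X)).inv ≫ t ▷ (A.X ⊗ A.X) ≫ (α_ A.X A.X A.X).inv ≫ μ[A.X] ▷ A.X =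
      leftMul t ▷ A.X := by
    refine hom_ext_pureTensor hZ hHom fun a b => ?_
    rw [comp_leftUnitor_inv_whiskerRight_assoc]
    simp
  rw [← h, comp_leftUnitor_inv_whiskerRight_assoc, ← pureTensor_whiskerLeft_assoc, ← hg,
    pureTensor_mul_assoc, mulZ_one]

theorem comp_regular_outer_right (hZ : (preadditiveCoyonedaObj (𝟙_ C)).Faithful)
    (hHom : (tensorLeft A.X).IsLeftAdjoint) {g : A.X ⟶ A.X ⊗ A.X}
    (hg : μ[A.X] ≫ g = g ▷ A.X ≫ (α_ A.X A.X A.X).hom ≫ A.X ◁ μ[A.X]) (t : 𝟙_ C ⟶ A.X) :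
    t ≫ g = (η[A.X] ≫ g) ≫ A.X ◁ rightMul t := by
  have h : (ρ_ (A.X ⊗ A.X)).inv ≫ (A.X ⊗ A.X) ◁ t ≫ (α_ A.X A.X A.X).hom ≫ A.X ◁ μ[A.X] =
      A.X ◁ rightMul t := by
    refine hom_ext_pureTensor hZ hHom fun a b => ?_
    rw [comp_rightUnitor_inv_whiskerLeft_assoc]
    simp
  rw [← h, comp_rightUnitor_inv_whiskerLeft_assoc, ← pureTensor_whiskerRight_assoc, ← hg,
    pureTensor_mul_assoc, one_mulZ]

/-- Over a separable monoid `A` with `A ⊗ A ∣ A`, every endomorphism of `A` is a twist by elements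
`a l`, `b l` with `∑ a l * b l = 1`. -/
theorem twistedDivides_map [MonoidalPreadditive C]
    (hZ : (preadditiveCoyonedaObj (𝟙_ C)).Faithful) (hHom : (tensorLeft A.X).IsLeftAdjoint)
    (hs : ∃ s : Bimod.regular A ⟶ outer A, s ≫ mulHom A = 𝟙 _)
    (hA : Divides (outer A) (Bimod.regular A)) (e : A ⟶ A) {θ : ZObj A → ZObj A}
    (hθ : ∀ t : 𝟙_ C ⟶ A.X, θ t = t ≫ e.hom) :
    TwistedDivides (Bimod.regular A) θ (Bimod.regular A) id := by
  obtain ⟨s, hs⟩ := hs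
  obtain ⟨k, hk, f, g, hfg⟩ := hA
  let S : A.X ⟶ A.X ⊗ A.X := s.hom
  have hS : S ≫ μ[A.X] = 𝟙 A.X := congrArg Bimod.Hom.hom hs
  let F (l : Fin k) : A.X ⊗ A.X ⟶ A.X := (f l).hom
  let D (l : Fin k) : A.X ⟶ A.X ⊗ A.X := (g l).hom
  have hFD : ∑ l, F l ≫ D l = 𝟙 (A.X ⊗ A.X) := hfg
  -- Write `∑ s' ⊗ s''` for the separability element `S(1)` and `∑ d' ⊗ d''` for `D_l(1)`. Then `z_l
  -- = F_l(1 ⊗ 1)`, `p_l = ∑ e(s') z_l s''` and `r_l = ∑ d' e(d'')`. The Casimir property of `S(1)`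
  -- and `D_l(1)` gives the intertwining relations `e(t) p_l = p_l t` and `t r_l = r_l e(t)`.
  let z (l : Fin k) : 𝟙_ C ⟶ A.X := pureTensor η[A.X] η[A.X] ≫ F l
  let p (l : Fin k) : 𝟙_ C ⟶ A.X := (η[A.X] ≫ S) ≫ (e.hom ⊗ₘ leftMul (z l)) ≫ μ[A.X]
  let r (l : Fin k) : 𝟙_ C ⟶ A.X := (η[A.X] ≫ D l) ≫ A.X ◁ e.hom ≫ μ[A.X]
  have hS' (t : 𝟙_ C ⟶ A.X) : (η[A.X] ≫ S) ≫ leftMul t ▷ A.X = (η[A.X] ≫ S) ≫ A.X ◁ rightMul t :=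
    (comp_regular_outer_left hZ hHom s.left_act_hom t).symm.trans (comp_regular_outer_right hZ hHom s.right_act_hom t)
  have hD (l) (t : 𝟙_ C ⟶ A.X) : t ≫ D l = (η[A.X] ≫ D l) ≫ leftMul t ▷ A.X :=
    comp_regular_outer_left hZ hHom (g l).left_act_hom t
  have hD' (l) (t : 𝟙_ C ⟶ A.X) :
      (η[A.X] ≫ D l) ≫ leftMul t ▷ A.X = (η[A.X] ≫ D l) ≫ A.X ◁ rightMul t :=
    (hD l t).symm.trans (comp_regular_outer_right hZ hHom (g l).right_act_hom t)
  have hp (l) (t : 𝟙_ C ⟶ A.X) : mulZ (t ≫ e.hom) (p l) = mulZ (p l) t := by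
    have h₁ : (e.hom ⊗ₘ leftMul (z l)) ≫ μ[A.X] ≫ leftMul (t ≫ e.hom) =
        leftMul t ▷ A.X ≫ (e.hom ⊗ₘ leftMul (z l)) ≫ μ[A.X] :=
      hom_ext_pureTensor hZ hHom fun a b => by simp
    have h₂ : (e.hom ⊗ₘ leftMul (z l)) ≫ μ[A.X] ≫ rightMul t =
        A.X ◁ rightMul t ≫ (e.hom ⊗ₘ leftMul (z l)) ≫ μ[A.X] :=
      hom_ext_pureTensor hZ hHom fun a b => by simp
    have h₃ := hS' t
    simp only [Category.assoc] at h₃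
    rw [← comp_leftMul, ← comp_rightMul]
    simp only [p, Category.assoc]
    rw [h₁, h₂, reassoc_of% h₃]
  have hr (l) (t : 𝟙_ C ⟶ A.X) : mulZ t (r l) = mulZ (r l) (t ≫ e.hom) := by
    have h₁ : A.X ◁ e.hom ≫ μ[A.X] ≫ leftMul t = leftMul t ▷ A.X ≫ A.X ◁ e.hom ≫ μ[A.X] :=
      hom_ext_pureTensor hZ hHom fun a b => by simp
    have h₂ : A.X ◁ e.hom ≫ μ[A.X] ≫ rightMul (t ≫ e.hom) =
        A.X ◁ rightMul t ≫ A.X ◁ e.hom ≫ μ[A.X] :=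
      hom_ext_pureTensor hZ hHom fun a b => by simp
    have h₃ := hD' l t
    simp only [Category.assoc] at h₃
    rw [← comp_leftMul, ← comp_rightMul]
    simp only [r, Category.assoc]
    rw [h₁, h₂, reassoc_of% h₃]
  -- Linearity of `D_l` gives `z_l D_l(1) = D_l(F_l(1 ⊗ 1))`, and these sum to `1 ⊗ 1`.
  have hzr : ∑ l, mulZ (z l) (r l) = η[A.X] := by
    have h (l) : mulZ (z l) (r l) =
        pureTensor η[A.X] η[A.X] ≫ (F l ≫ D l) ≫ A.X ◁ e.hom ≫ μ[A.X] := by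
      have h₁ : A.X ◁ e.hom ≫ μ[A.X] ≫ leftMul (z l) =
          leftMul (z l) ▷ A.X ≫ A.X ◁ e.hom ≫ μ[A.X] :=
        hom_ext_pureTensor hZ hHom fun a b => by simp
      have h₂ := hD l (z l)
      simp only [Category.assoc] at h₂
      rw [← comp_leftMul, Category.assoc, Category.assoc, Category.assoc, h₁, ← reassoc_of% h₂]
      simp only [z, Category.assoc]
    rw [Finset.sum_congr rfl fun l _ => h l, ← Preadditive.comp_sum, ← Preadditive.sum_comp, hFD]
    simp
  -- Moving `s''` across `r_l` gives `∑ e(s') z_l r_l e(s'') = ∑ e(s') e(s'') = e(∑ s' s'') = 1`.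
  have hpr : ∑ l, mulZ (p l) (r l) = η[A.X] := by
    have h₁ : ∑ l, (e.hom ⊗ₘ leftMul (z l)) ≫ μ[A.X] ≫ rightMul (r l) = μ[A.X] ≫ e.hom := by
      refine hom_ext_pureTensor hZ hHom fun a b => ?_
      have h₂ (l) : pureTensor a b ≫ (e.hom ⊗ₘ leftMul (z l)) ≫ μ[A.X] ≫ rightMul (r l) =
          mulZ (z l) (r l) ≫ rightMul (b ≫ e.hom) ≫ leftMul (a ≫ e.hom) := by
        simp [hr l b]
      rw [Preadditive.comp_sum, Finset.sum_congr rfl fun l _ => h₂ l, ← Preadditive.sum_comp, hzr]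
      simp
    have h₂ (l) : mulZ (p l) (r l) =
        (η[A.X] ≫ S) ≫ (e.hom ⊗ₘ leftMul (z l)) ≫ μ[A.X] ≫ rightMul (r l) := by
      rw [← comp_rightMul]
      simp only [p, Category.assoc]
    rw [Finset.sum_congr rfl fun l _ => h₂ l, ← Preadditive.comp_sum, h₁, Category.assoc,
      reassoc_of% hS]
    simp
  refine twistedDivides_iff.2 ⟨k, hk, p, r, fun l t => ?_, fun l t => ?_, hpr⟩
  · rw [hθ]; exact hp l t
  · rw [hθ]; exact hr l t

/-- The same elements `a_l`, `b_l` work: substituting `θ z` for `z` turns intertwiners for `(θ', 1)`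
into intertwiners for `(1, θ)`. -/
theorem TwistedDivides.of_leftInverse [MonoidalPreadditive C] {θ θ' : ZObj A → ZObj A}
    (h : TwistedDivides (Bimod.regular A) θ' (Bimod.regular A) id)
    (hθ : Function.LeftInverse θ' θ) :
    TwistedDivides (Bimod.regular A) id (Bimod.regular A) θ := by
  obtain ⟨k, hk, a, b, ha, hb, hab⟩ := twistedDivides_iff.1 h
  refine twistedDivides_iff.2 ⟨k, hk, a, b, fun l z => ?_, fun l z => ?_, hab⟩
  · have := ha l (θ z)
    rwa [hθ z] at this
  · have := hb l (θ z)
    rwa [hθ z] at this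

end Automorphisms

/-! ### The homomorphism `Γ` -/
section GammaAut

variable {C : Type u} [Category.{v} C] [MonoidalCategory C] [Preadditive C] [SymmetricCategory C]
  {A : Mon C}

/-- The automorphism `Γ_X`, for a chosen inverse of `X`. -/
noncomputable def Inv.gammaAut (hZ : (preadditiveCoyonedaObj (𝟙_ C)).Faithful)
    (hHom : (tensorLeft A.X).IsLeftAdjoint) (x : Inv A) : Aut A :=
  (Classical.choice x.2.choose_spec).gammaAut hZ hHom

/-- Removes the choice of inverse: any representative of `X` with any inverse computes the same
action. -/
theorem Inv.comp_gammaAut (hZ : (preadditiveCoyonedaObj (𝟙_ C)).Faithful)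
    (hHom : (tensorLeft A.X).IsLeftAdjoint) (x : Inv A) {X Y : C} {i : X ⟶ A.X} {j : Y ⟶ A.X}
    [Mono i] (d : InverseDatum A i j) (hx : x.1 = Subobject.mk i) (t : 𝟙_ C ⟶ A.X) :
    t ≫ (x.gammaAut hZ hHom).hom.hom = d.conj t :=
  (InverseDatum.comp_gamma hZ _ t).trans
    (InverseDatum.conj_congr hZ _ d ((Subobject.mk_arrow _).trans hx) t)

theorem Inv.gammaAut_mul (hZ : (preadditiveCoyonedaObj (𝟙_ C)).Faithful)
    (hHom : (tensorLeft A.X).IsLeftAdjoint) (x x' : Inv A) :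
    (x * x').gammaAut hZ hHom = x.gammaAut hZ hHom * x'.gammaAut hZ hHom := by
  obtain ⟨y, ⟨d⟩⟩ := x.2
  obtain ⟨y', ⟨d'⟩⟩ := x'.2
  have h (t : 𝟙_ C ⟶ A.X) : t ≫ ((x * x').gammaAut hZ hHom).hom.hom =
      t ≫ (x'.gammaAut hZ hHom).hom.hom ≫ (x.gammaAut hZ hHom).hom.hom := by
    rw [Inv.comp_gammaAut hZ hHom (x * x') (d.tensor d') rfl, d.conj_tensor hZ,
      ← Category.assoc, Inv.comp_gammaAut hZ hHom x' d' (by simp),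
      Inv.comp_gammaAut hZ hHom x d (by simp)]
  ext
  exact hom_ext_elements hZ h

end GammaAut

/-! ### Comparison of the groups -/

section Comparison

variable {C : Type u} [Category.{v} C] [MonoidalCategory C] [Abelian C] [MonoidalPreadditive C]

theorem omega_injective (hZ : (preadditiveCoyonedaObj (𝟙_ C)).Faithful) (A : Mon C) :
    Function.Injective (Omega A) := by
  intro e e' h
  have h' (t : 𝟙_ C ⟶ A.X) : t ≫ e.hom.hom = t ≫ e'.hom.hom := DFunLike.congr_fun h t
  ext
  exact hom_ext_elements hZ h'

variable [SymmetricCategory C] {A : Mon C}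

/-- One divisibility comes from `e` itself, the other from its inverse by untwisting. -/
theorem range_omega_subset_setH (hZ : (preadditiveCoyonedaObj (𝟙_ C)).Faithful)
    [hAz : IsAzumaya A] (hHom : (tensorLeft A.X).IsLeftAdjoint)
    (hA : Divides (outer A) (Bimod.regular A)) : Set.range (Omega A) ⊆ setH A := by
  rintro _ ⟨e, rfl⟩
  refine ⟨twistedDivides_map hZ hHom hAz.splits hA e.hom fun _ => rfl,
    (twistedDivides_map hZ hHom hAz.splits hA e.inv (θ := (Omega A e).symm)
      fun _ => rfl).of_leftInverse (Omega A e).left_inv⟩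

variable [WellPowered.{v} C] [HasLimits C]

/-- The intertwining relations say exactly that the `a_l` lie in `J σ δ` and the `b_l` in `J δ σ`.
With both diagonal `J`'s identified with `𝟙`, the dual basis lemma applies. -/
theorem isIso_jMul (hZ : (preadditiveCoyonedaObj (𝟙_ C)).Faithful) [IsAzumaya A]
    (hHom : (tensorLeft A.X).IsLeftAdjoint) {σ δ : ZObj A → ZObj A}
    (hσ : Function.Surjective σ) (hδ : Function.Surjective δ)
    (h : TwistedDivides (Bimod.regular A) σ (Bimod.regular A) δ) : IsIso (jMul A σ δ σ) := by
  obtain ⟨k, -, a, b, ha, hb, hab⟩ := twistedDivides_iff.1 h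
  obtain ⟨e₁, he₁⟩ := exists_iso_J_diag hZ A hHom hσ
  obtain ⟨e₂, he₂⟩ := exists_iso_J_diag hZ A hHom hδ
  have ha' (l) : (J.{v, u} A σ δ).Factors (a l) := (factors_J_iff _).2 fun t =>
    (comp_leftMul _ _).trans ((ha l t).trans (comp_rightMul _ _).symm)
  have hb' (l) : (J.{v, u} A δ σ).Factors (b l) := (factors_J_iff _).2 fun t =>
    (comp_leftMul _ _).trans ((hb l t).trans (comp_rightMul _ _).symm)
  have hm : (jMul A σ δ σ ≫ e₁.hom) ≫ η[A.X] =
      ((J.{v, u} A σ δ).arrow ⊗ₘ (J.{v, u} A δ σ).arrow) ≫ μ[A.X] := by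
    rw [Category.assoc, he₁, jMul_arrow]
  have hm' : (jMul A δ σ δ ≫ e₂.hom) ≫ η[A.X] =
      ((J.{v, u} A δ σ).arrow ⊗ₘ (J.{v, u} A σ δ).arrow) ≫ μ[A.X] := by
    rw [Category.assoc, he₂, jMul_arrow]
  have := isIso_of_sum_mulZ hm hm' (fun l => (J.{v, u} A σ δ).factorThru (a l) (ha' l))
    (fun l => (J.{v, u} A δ σ).factorThru (b l) (hb' l)) (by simpa using hab)
  exact IsIso.of_isIso_comp_right (jMul A σ δ σ) e₁.hom

theorem Inv.gammaAut_injective (hZ : (preadditiveCoyonedaObj (𝟙_ C)).Faithful) [IsAzumaya A]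
    (hHom : (tensorLeft A.X).IsLeftAdjoint) :
    Function.Injective (Inv.gammaAut (A := A) hZ hHom) := by
  -- The subobject is recovered from its action.
  have h (x : Inv A) : x.1 = J.{v, u} A (Omega A (x.gammaAut hZ hHom)) id := by
    obtain ⟨y, ⟨d⟩⟩ := x.2
    rw [← d.mk_eq_J hZ hHom (θ := Omega A (x.gammaAut hZ hHom))
      fun t => Inv.comp_gammaAut hZ hHom x d (by simp) t]
    simp
  intro x x' hx
  apply Subtype.ext
  rw [h x, h x', hx]

variable [HasColimits C]

theorem setH_subset_setG (hZ : (preadditiveCoyonedaObj (𝟙_ C)).Faithful) [IsAzumaya A]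
    (hHom : (tensorLeft A.X).IsLeftAdjoint) : setH A ⊆ setG A := fun θ h =>
  ⟨(isIso_jMulBar_iff hZ A hHom _ _ Function.surjective_id).2
      (isIso_jMul hZ hHom θ.surjective Function.surjective_id h.1),
    (isIso_jMulBar_iff hZ A hHom _ _ θ.surjective).2
      (isIso_jMul hZ hHom Function.surjective_id θ.surjective h.2)⟩

theorem exists_inv_of_mem_setG (hZ : (preadditiveCoyonedaObj (𝟙_ C)).Faithful) [IsAzumaya A]
    (hHom : (tensorLeft A.X).IsLeftAdjoint) {θ : AutZ A} (h : θ ∈ setG A) :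
    ∃ x : Inv A, Omega A (x.gammaAut hZ hHom) = θ := by
  obtain ⟨d⟩ := nonempty_inverseDatum_J hZ hHom θ.surjective
    ((isIso_jMulBar_iff hZ A hHom _ _ Function.surjective_id).1 h.1)
    ((isIso_jMulBar_iff hZ A hHom _ _ θ.surjective).1 h.2)
  let x : Inv A := ⟨J.{v, u} A θ id, _, ⟨d⟩⟩
  refine ⟨x, ?_⟩
  ext t
  exact (Inv.comp_gammaAut hZ hHom x d (by simp [x]) t).trans (d.conj_eq_of_J hZ t)

end Comparison

end AzumayaMonoid

theorem mainTheorem3 {C : Type u} [Category.{v} C] [MonoidalCategory C]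
    [SymmetricCategory C] [Abelian C] [MonoidalPreadditive C] [WellPowered.{v} C]
    [HasLimits C] [HasColimits C]
    [∀ X : C, PreservesFiniteColimits (tensorLeft X)]
    [∀ X : C, PreservesFiniteColimits (tensorRight X)]
    (hZ : (preadditiveCoyonedaObj (𝟙_ C)).Faithful)
    (A : Mon C) [AzumayaMonoid.IsAzumaya A] (hHom : (tensorLeft A.X).IsLeftAdjoint)
    (hA : AzumayaMonoid.Divides (AzumayaMonoid.outer A) (Bimod.regular A)) :
    ∃ (G : Subgroup (AzumayaMonoid.AutZ A)) (Γ : AzumayaMonoid.Inv A ≃* Aut A) (ω : Aut A ≃* G)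
      (Φ : AzumayaMonoid.Inv A →* AzumayaMonoid.AutZ A) (Φh : AzumayaMonoid.Inv A ≃* G),
      (G : Set (AzumayaMonoid.AutZ A)) = AzumayaMonoid.setG A ∧
      AzumayaMonoid.setG A = AzumayaMonoid.setH A ∧
      (∀ (x : AzumayaMonoid.Inv A) {X Y : C} (i : X ⟶ A.X) (j : Y ⟶ A.X) [Mono i] [Mono j]
        (d : AzumayaMonoid.InverseDatum A i j), x.1 = Subobject.mk i →
          (Γ x).hom.hom = AzumayaMonoid.gamma d) ∧
      (∀ (x : AzumayaMonoid.Inv A) {X Y : C} (i : X ⟶ A.X) (j : Y ⟶ A.X) [Mono i] [Mono j]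
        (d : AzumayaMonoid.InverseDatum A i j), x.1 = Subobject.mk i →
          ∀ t : AzumayaMonoid.ZObj A, Φ x t = AzumayaMonoid.miyashita d t) ∧
      Function.Injective (AzumayaMonoid.Omega A) ∧
      (AzumayaMonoid.Omega A).comp Γ.toMonoidHom = Φ ∧
      G.subtype.comp ω.toMonoidHom = AzumayaMonoid.Omega A ∧
      G.subtype.comp Φh.toMonoidHom = Φ ∧
      ω.toMonoidHom.comp Γ.toMonoidHom = Φh.toMonoidHom := by
  have hHG := AzumayaMonoid.setH_subset_setG hZ (A := A) hHom
  have hRH := AzumayaMonoid.range_omega_subset_setH hZ hHom hA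
  have hGR : AzumayaMonoid.setG A ⊆ Set.range (AzumayaMonoid.Omega A) := fun θ h =>
    let ⟨x, hx⟩ := AzumayaMonoid.exists_inv_of_mem_setG hZ hHom h
    ⟨x.gammaAut hZ hHom, hx⟩
  have hΩ := AzumayaMonoid.omega_injective hZ A
  let Γ₀ : AzumayaMonoid.Inv A →* Aut A :=
    MonoidHom.mk' (AzumayaMonoid.Inv.gammaAut hZ hHom) (AzumayaMonoid.Inv.gammaAut_mul hZ hHom)
  have hΓ : Function.Bijective Γ₀ := by
    -- Surjectivity: `Ω(e)` lies in `G`, hence equals `Ω(Γ_X)` for some `X`, and `Ω` is injective.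
    refine ⟨AzumayaMonoid.Inv.gammaAut_injective hZ hHom, fun e => ?_⟩
    obtain ⟨x, hx⟩ := AzumayaMonoid.exists_inv_of_mem_setG hZ hHom
      (hHG (hRH (Set.mem_range_self e)))
    exact ⟨x, hΩ hx⟩
  let Γ := MulEquiv.ofBijective Γ₀ hΓ
  let ω := MonoidHom.ofInjective hΩ
  -- Both versions of `Φ` are built from `Γ` and `Ω`, so the four identities of the diagram hold by
  -- definition. What needs proof is the comparison with the explicit formulas for `Γ_X` and `Φ_X`.
  refine ⟨(AzumayaMonoid.Omega A).range, Γ, ω, (AzumayaMonoid.Omega A).comp Γ.toMonoidHom,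
    Γ.trans ω, ?_, (hGR.trans hRH).antisymm hHG, ?_, ?_, hΩ, rfl, rfl, rfl, rfl⟩
  · exact (MonoidHom.coe_range _).trans ((hRH.trans hHG).antisymm hGR)
  · intro x X Y i j _ _ d hx
    refine AzumayaMonoid.hom_ext_elements hZ fun t => ?_
    rw [d.comp_gamma hZ]
    exact x.comp_gammaAut hZ hHom d hx t
  · intro x X Y i j _ _ d hx t
    exact (x.comp_gammaAut hZ hHom d hx t).trans (d.miyashita_eq_conj t).symm
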